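/- For $x=(x_1,x_2)\in\mathbb R^2$ write $x^\perp=(-x_2,x_1)$. Let $\Omega\subset\mathbb R^2$ be open, let $p\in[1,3]$, and let $u\in W^{1/p,p}_{\mathrm{loc}}(\Omega,\mathbb R^2)$ satisfy $|u|=1$ a.e. in $\Omega$ and $\nabla\cdot u=0$ in $\mathcal D'(\Omega)$. (Here $u\in W^{1/p,p}_{\mathrm{loc}}$ means that $u\in L^p_{\mathrm{loc}}(\Omega)$ and, for $p>1$, $\int_K\int_K \frac{|u(x)-u(y)|^p}{|x-y|^{3}}\,dx\,dy<\infty$ for every compact $K\subset\Omega$, while for $p=1$ the weak derivative of $u$ lies in $L^1_{\mathrm{loc}}(\Omega)$.) Then, after modification on a null set, $u$ is locally Lipschitz continuous in $\Omega\setminus S$, where $S\subset\Omega$ is a locally finite set, i.e. every point of $\Omega$ has a neighbourhood containing only finitely many points of $S$. Moreover, every $P\in S$ is a vortex point of degree $1$ of $u$: there is a sign $\alpha\in\{1,-1\}$ such that $$u(x)=\alpha\,\frac{(x-P)^\perp}{|x-P|}$$ for every convex neighbourhood $\omega\subset\Omega$ of $P$ and every $x\in\omega$ with $x\neq P$. 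-/

import Mathlib

open MeasureTheory Topology
open scoped ContDiff

noncomputable section

/-- The Euclidean plane `ℝ²`. -/
abbrev Plane : Type := EuclideanSpace ℝ (Fin 2)

/-- The rotation `x = (x₁, x₂) ↦ x^⊥ = (-x₂, x₁)`. -/
def perp (x : Plane) : Plane := !₂[-x 1, x 0]

/-- Test functions: real-valued `C^∞` functions with compact support contained in `Ω`. -/
structure IsTestFunction (Ω : Set Plane) (φ : Plane → ℝ) : Prop where
  smooth : ContDiff ℝ ∞ φ
  compact_support : HasCompactSupport φ
  support_subset : tsupport φ ⊆ Ω

/-- `f ∈ L^p_loc(Ω)`. -/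
def MemLpLoc {F : Type*} [NormedAddCommGroup F] (p : ℝ) (Ω : Set Plane) (f : Plane → F) : Prop :=
  ∀ K : Set Plane, IsCompact K → K ⊆ Ω → MemLp f (ENNReal.ofReal p) (volume.restrict K)

/-- `G` is the weak (distributional) differential of `u` in `Ω`. -/
def IsWeakDeriv (Ω : Set Plane) (u : Plane → Plane) (G : Plane → Plane →L[ℝ] Plane) : Prop :=
  ∀ φ : Plane → ℝ, IsTestFunction Ω φ → ∀ v : Plane,
    ∫ x in Ω, fderiv ℝ φ x v • u x = -∫ x in Ω, φ x • G x v

/-- Finiteness of the local Gagliardo seminorms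
`∫_K ∫_K |u(x) - u(y)|^p / |x - y|^(2 + sp) dy dx` for all compact `K ⊆ Ω`. -/
def GagliardoFiniteLoc (s p : ℝ) (Ω : Set Plane) (u : Plane → Plane) : Prop :=
  ∀ K : Set Plane, IsCompact K → K ⊆ Ω →
    ∫⁻ x in K, ∫⁻ y in K, ENNReal.ofReal (‖u x - u y‖ ^ p / ‖x - y‖ ^ (2 + s * p)) < ⊤

/-- `u ∈ W^{s,p}_loc(Ω, ℝ²)` for an order `0 < s ≤ 1` (no function belongs for other `s`): for
`s = 1` through weak derivatives, for `0 < s < 1` through the Gagliardo seminorm. -/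
def MemSobolevLoc (s p : ℝ) (Ω : Set Plane) (u : Plane → Plane) : Prop :=
  MemLpLoc p Ω u ∧
    ((s = 1 ∧ ∃ G : Plane → Plane →L[ℝ] Plane, MemLpLoc p Ω G ∧ IsWeakDeriv Ω u G) ∨
      (0 < s ∧ s < 1 ∧ GagliardoFiniteLoc s p Ω u))

/-- `∇ · u = 0` in the sense of distributions: `∫_Ω u · ∇φ = 0` for all test functions `φ`. -/
def IsDivFree (Ω : Set Plane) (u : Plane → Plane) : Prop :=
  ∀ φ : Plane → ℝ, IsTestFunction Ω φ → ∫ x in Ω, fderiv ℝ φ x (u x) = 0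

/-- `u ∈ W^{s,p}_div(Ω, S¹)`: unit-length divergence-free fields in `W^{s,p}_loc(Ω, ℝ²)`. -/
structure MemSobolevDiv (s p : ℝ) (Ω : Set Plane) (u : Plane → Plane) : Prop where
  sobolev : MemSobolevLoc s p Ω u
  unit_length : ∀ᵐ x ∂volume.restrict Ω, ‖u x‖ = 1
  div_free : IsDivFree Ω u

end

/-! ### Planar linear algebra -/

open scoped RealInnerProductSpace

/-! Everything rests on a kinetic equation: for every unit vector ξ, ξ · ∇ sign(ξ · u) = 0 in Ω
(`integral_fderiv_mul_sign_eq_zero`). Consequently, if a segment joining two Lebesgue points x, y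
lies in Ω, the components of u along y - x at its two ends never have opposite signs (`sign_rule`).
The rest is plane geometry of fields obeying this rule on a dense set (`IsCharacteristicField`).

For the kinetic equation, u is mollified to u_ε. Along a smooth divergence-free field, the
divergence of a suitable entropy Φ_δ(u_ε) is the defect 1 - |u_ε|² times a combination of first
derivatives of u_ε (`entropy_production`). The defect is a variance, hence quadratic in the
increments of u, and the gradient is linear in them, so the product is at most a constant times ε⁻³
∫ |u(y) - u(x)|³ dy over the ε-ball. As |u| = 1, the cube is dominated by the p-th power for p ≤ 3,
and the Gagliardo integral over |x - y| ≤ ε tends to 0. When p = 1 there is instead an integrable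
weak gradient, multiplied by a defect that is bounded and tends to 0 almost everywhere. In both
cases div Φ_δ(u) = 0, and Φ_δ(u) tends to sign(ξ · u) ξ as δ → 0.

Call the line through x orthogonal to u(x) the characteristic of x. The sign rule makes u orthogonal
to it all along (`inner_eq_zero`). If two characteristics cross at a point z of an open convex set,
all others in that set must pass through z, and u is a vortex there (`Crosses.eq_vortex`). If none
cross in a ball of radius R, the characteristics of two points near its centre can meet only at
distance at least R/2, so their angle is O(|x - y| / R) and u is Lipschitz
(`norm_sub_le_of_not_crosses`). A ball inside Ω therefore contains at most one vortex centre. -/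

theorem plane_inner (x y : Plane) : ⟪x, y⟫ = x 0 * y 0 + x 1 * y 1 := by
  simp [PiLp.inner_apply, Fin.sum_univ_two]; ring

theorem plane_norm_sq (x : Plane) : ‖x‖ ^ 2 = x 0 ^ 2 + x 1 ^ 2 := by
  rw [← real_inner_self_eq_norm_sq, plane_inner]; ring

@[simp] theorem perp_zero_coord (x : Plane) : perp x 0 = -x 1 := by simp [perp]

@[simp] theorem perp_one_coord (x : Plane) : perp x 1 = x 0 := by simp [perp]

theorem inner_perp_self (x : Plane) : ⟪perp x, x⟫ = 0 := by
  rw [plane_inner]; simp; ring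

theorem norm_perp (x : Plane) : ‖perp x‖ = ‖x‖ := by
  have h : ‖perp x‖ ^ 2 = ‖x‖ ^ 2 := by rw [plane_norm_sq, plane_norm_sq]; simp; ring
  exact (sq_eq_sq₀ (norm_nonneg _) (norm_nonneg _)).1 h

/-- The planar cross product. -/
def planeCross (x y : Plane) : ℝ := x 0 * y 1 - x 1 * y 0

theorem plane_ext {x y : Plane} (h0 : x 0 = y 0) (h1 : x 1 = y 1) : x = y := by
  ext i; fin_cases i <;> assumption

/-- A unit vector orthogonal to `d ≠ 0` is one of the two rotations of `d / ‖d‖`. -/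
theorem eq_perp_of_inner_eq_zero {e d : Plane} (he : ‖e‖ = 1) (hd : d ≠ 0) (h : ⟪e, d⟫ = 0) :
    ∃ α : ℝ, (α = 1 ∨ α = -1) ∧ e = (α / ‖d‖) • perp d := by
  have hd' : ‖d‖ ≠ 0 := norm_ne_zero_iff.2 hd
  have hd2 := plane_norm_sq d
  have he2 := plane_norm_sq e
  rw [he] at he2
  rw [plane_inner] at h
  refine ⟨planeCross d e / ‖d‖, ?_, ?_⟩
  · have : (planeCross d e / ‖d‖) ^ 2 = 1 := by
      rw [div_pow, div_eq_one_iff_eq (by positivity), hd2]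
      unfold planeCross
      linear_combination (-(e 0 * d 0 + e 1 * d 1)) * h - (d 0 ^ 2 + d 1 ^ 2) * he2
    exact sq_eq_one_iff.1 this
  · have key : ∀ t : ℝ, planeCross d e / ‖d‖ / ‖d‖ * t = planeCross d e * t / ‖d‖ ^ 2 := by
      intro t; field_simp
    apply plane_ext
    · simp only [PiLp.smul_apply, perp_zero_coord, smul_eq_mul, key]
      rw [eq_div_iff (by positivity), hd2]
      unfold planeCross
      linear_combination d 0 * h
    · simp only [PiLp.smul_apply, perp_one_coord, smul_eq_mul, key]
      rw [eq_div_iff (by positivity), hd2]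
      unfold planeCross
      linear_combination d 1 * h

theorem mul_nonneg_of_sign {s p t : ℝ} (h : 0 < s * p) (h' : 0 ≤ p * t) : 0 ≤ s * t := by
  have hp : p ≠ 0 := by rintro rfl; simp at h
  have h1 : 0 ≤ s * t * (p * p) := by
    have := mul_nonneg h.le h'
    linarith
  exact nonneg_of_mul_nonneg_left h1 (mul_self_pos.2 hp)

/-- `κ * a * X` and `κ * b * Y` are bounded above in terms of `Q`, and their sum is bounded below,
so each is pinched to size O(`σ`). In the application `Q`, `X`, `Y` are the components of the field
at a point `q` along `q - z`, `x - z`, `y - z`. The constant is symmetric in `a` and `b` so that it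
also serves for `Y`. -/
theorem sector_bound {κ a b X Y Q σ : ℝ} (hκ : κ ≠ 0) (ha : a ≠ 0) (hQ : |Q| ≤ σ) (x1 : 0 ≤ κ * a * (Q - X))
    (y1 : 0 ≤ κ * b * (Q - Y)) (w1 : 0 ≤ -κ * (Q - (a * X + b * Y))) :
    |X| ≤ (1 + |a| + |b|) * (1 / |a| + 1 / |b|) * σ := by
  have hκpos : 0 < |κ| := abs_pos.2 hκ
  have k1 : |κ * Q| ≤ |κ| * σ := by
    rw [abs_mul]; exact mul_le_mul_of_nonneg_left hQ hκpos.le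
  have k2 : |κ * a * Q| ≤ |κ| * |a| * σ := by
    rw [abs_mul, abs_mul]; exact mul_le_mul_of_nonneg_left hQ (by positivity)
  have k3 : |κ * b * Q| ≤ |κ| * |b| * σ := by
    rw [abs_mul, abs_mul]; exact mul_le_mul_of_nonneg_left hQ (by positivity)
  have σ0 : 0 ≤ σ := (abs_nonneg _).trans hQ
  have p1 : 0 ≤ |κ| * σ := by positivity
  have p2 : 0 ≤ |κ| * |a| * σ := by positivity
  have p3 : 0 ≤ |κ| * |b| * σ := by positivity
  rw [abs_le] at k1 k2 k3
  have h1 : |κ * a * X| ≤ |κ| * ((1 + |a| + |b|) * σ) := by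
    rw [abs_le]; constructor <;> linarith
  rw [abs_mul, abs_mul, mul_assoc] at h1
  have h2 := le_of_mul_le_mul_left h1 hκpos
  have apos : 0 < |a| := abs_pos.2 ha
  calc |X| ≤ (1 + |a| + |b|) * σ / |a| := by rwa [le_div_iff₀ apos, mul_comm]
    _ = (1 + |a| + |b|) * (1 / |a|) * σ := by ring
    _ ≤ (1 + |a| + |b|) * (1 / |a| + 1 / |b|) * σ := by
      gcongr
      exact le_add_of_nonneg_right (by positivity)

/-- The vector `⟪e, p⟫ • q - ⟪e, q⟫ • p` is orthogonal to `e` and its length is the cross product.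
In use: a unit vector cannot be nearly orthogonal to two independent directions. -/
theorem abs_cross_le {e p q : Plane} (he : ‖e‖ = 1) :
    |planeCross p q| ≤ |⟪e, p⟫| * ‖q‖ + |⟪e, q⟫| * ‖p‖ := by
  have e2 := plane_norm_sq e
  rw [he] at e2
  have hv : ‖⟪e, p⟫ • q - ⟪e, q⟫ • p‖ = |planeCross p q| := by
    have h2 : ‖⟪e, p⟫ • q - ⟪e, q⟫ • p‖ ^ 2 = |planeCross p q| ^ 2 := by
      rw [plane_norm_sq, sq_abs, plane_inner, plane_inner]
      unfold planeCross
      simp only [PiLp.sub_apply, PiLp.smul_apply, smul_eq_mul]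
      linear_combination (-(p 0 * q 1 - p 1 * q 0) ^ 2) * e2
    exact (sq_eq_sq₀ (norm_nonneg _) (abs_nonneg _)).1 h2
  rw [← hv]
  refine (norm_sub_le _ _).trans ?_
  rw [norm_smul, norm_smul]; rfl

/-! ### Sign rule: straight characteristics and crossings -/

/-- The sign rules satisfied, at its Lebesgue points `D`, by a unit field `m` on `Ω` that solves the
kinetic equation `ξ · ∇ sign (m · ξ) = 0`. -/
structure IsCharacteristicField (Ω D : Set Plane) (m : Plane → Plane) : Prop where
  norm_eq_one : ∀ x ∈ D, ‖m x‖ = 1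
  dense : Ω ⊆ closure D
  sign : ∀ x ∈ D, ∀ y ∈ D, segment ℝ x y ⊆ Ω → 0 ≤ ⟪m x, y - x⟫ * ⟪m y, y - x⟫
  approx : ∀ x ∈ D, ∀ e : Plane, e ≠ 0 → ∀ η : ℝ, 0 < η →
    ∃ z ∈ D, ‖z - x‖ < η ∧ ‖m z - m x‖ < η ∧ 0 < ⟪e, z - x⟫

namespace IsCharacteristicField

variable {Ω D U : Set Plane} {m : Plane → Plane}

theorem inter_nonempty (H : IsCharacteristicField Ω D m) {V : Set Plane} (hV : IsOpen V)
    (hVΩ : V ⊆ Ω) (hne : V.Nonempty) : ∃ q ∈ D, q ∈ V := by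
  obtain ⟨x, hx⟩ := hne
  obtain ⟨q, hq⟩ := mem_closure_iff.1 (H.dense (hVΩ hx)) V hV hx
  exact ⟨q, hq.2, hq.1⟩

/-- Characteristics are straight: if `y` lies on the line through `x` orthogonal to `m x`, then
`m y` is orthogonal to it, too. -/
theorem inner_eq_zero (H : IsCharacteristicField Ω D m) (hU : IsOpen U) (hc : Convex ℝ U)
    (hUΩ : U ⊆ Ω) {x y : Plane} (hx : x ∈ D) (hxU : x ∈ U) (hy : y ∈ D) (hyU : y ∈ U)
    (h : ⟪m x, y - x⟫ = 0) : ⟪m y, y - x⟫ = 0 := by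
  by_contra hne
  set c := ⟪m y, y - x⟫ with hcdef
  have hcpos : 0 < |c| := abs_pos.2 hne
  have hmx : m x ≠ 0 := by
    intro h0; have := H.norm_eq_one x hx; rw [h0] at this; simp at this
  obtain ⟨r, hr, hball⟩ := Metric.isOpen_iff.1 hU y hyU
  -- Stepping from `y` to `z` in the direction `-c • m x` gives `⟪m x, z - x⟫` the sign opposite to
  -- `c`, while this radius keeps `⟪m z, z - x⟫` within `|c| / 2` of `c`. That violates the sign
  -- rule for `x` and `z`.
  set η := min r (|c| / (2 * (1 + ‖y - x‖))) with hη
  have hηpos : 0 < η := lt_min hr (by positivity)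
  obtain ⟨z, hz, hzy, hmz, hez⟩ := H.approx y hy (-c • m x)
    (by simp [hne, hmx]) η hηpos
  have hzU : z ∈ U := hball (by rw [mem_ball_iff_norm]; exact hzy.trans_le (min_le_left _ _))
  have hs := H.sign x hx z hz ((hc.segment_subset hxU hzU).trans hUΩ)
  have e1 : ⟪m x, z - x⟫ = ⟪m x, z - y⟫ := by
    have : z - x = (z - y) + (y - x) := by abel
    rw [this, inner_add_right, h, add_zero]
  rw [e1] at hs
  have e2 : |⟪m z, z - x⟫ - c| < |c| := by
    have : ⟪m z, z - x⟫ - c = ⟪m z, z - y⟫ + ⟪m z - m y, y - x⟫ := by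
      rw [hcdef, inner_sub_left]
      have : z - x = (z - y) + (y - x) := by abel
      rw [this, inner_add_right]; ring
    rw [this]
    have b1 := abs_real_inner_le_norm (m z) (z - y)
    have b2 := abs_real_inner_le_norm (m z - m y) (y - x)
    rw [H.norm_eq_one z hz, one_mul] at b1
    have b3 : ‖m z - m y‖ * ‖y - x‖ ≤ η * ‖y - x‖ :=
      mul_le_mul_of_nonneg_right hmz.le (norm_nonneg _)
    have b4 : η * (1 + ‖y - x‖) ≤ |c| / 2 := by
      calc η * (1 + ‖y - x‖) ≤ |c| / (2 * (1 + ‖y - x‖)) * (1 + ‖y - x‖) :=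
            mul_le_mul_of_nonneg_right (min_le_right _ _) (by positivity)
        _ = |c| / 2 := by field_simp
    have := abs_add_le ⟪m z, z - y⟫ ⟪m z - m y, y - x⟫
    nlinarith [norm_nonneg (y - x)]
  rw [inner_smul_left] at hez
  have h1 : 0 ≤ -c * ⟪m z, z - x⟫ := mul_nonneg_of_sign (by simpa using hez) hs
  have h2 := sq_lt_sq.2 e2
  nlinarith [mul_self_pos.2 hne, sq_nonneg ⟪m z, z - x⟫]

/-- The lines orthogonal to `m x` at `x` and to `m y` at `y` meet transversally at `z`. -/
structure Crosses (D : Set Plane) (m : Plane → Plane) (U : Set Plane) (z x y : Plane) : Prop where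
  mem : x ∈ D ∧ x ∈ U ∧ y ∈ D ∧ y ∈ U
  left : ⟪m x, x - z⟫ = 0
  right : ⟪m y, y - z⟫ = 0
  transversal : planeCross (x - z) (y - z) ≠ 0

/-- For independent `e` and `f` the sector at `z` is open and nonempty at every scale, Cramer's rule
giving a direction inside it; the dense set `D` meets it. -/
theorem exists_mem_sector (H : IsCharacteristicField Ω D m) (hU : IsOpen U) (hUΩ : U ⊆ Ω)
    {z : Plane} (hz : z ∈ U) {e f : Plane} (hef : planeCross e f ≠ 0) (s t : ℝ) (hs : s ≠ 0) (ht : t ≠ 0)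
    {η : ℝ} (hη : 0 < η) :
    ∃ q ∈ D, q ∈ U ∧ ‖q - z‖ < η ∧ 0 < s * ⟪e, q - z⟫ ∧ 0 < t * ⟪f, q - z⟫ := by
  obtain ⟨d, hd1, hd2⟩ : ∃ d : Plane, ⟪e, d⟫ = s ∧ ⟪f, d⟫ = t := by
    refine ⟨!₂[(s * f 1 - t * e 1) / planeCross e f, (t * e 0 - s * f 0) / planeCross e f], ?_, ?_⟩ <;>
    · rw [plane_inner]
      simp
      field_simp
      unfold planeCross; ring
  let V : Set Plane := (U ∩ Metric.ball z η) ∩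
    ({q | 0 < s * ⟪e, q - z⟫} ∩ {q | 0 < t * ⟪f, q - z⟫})
  have hVo : IsOpen V := by
    refine (hU.inter Metric.isOpen_ball).inter (IsOpen.inter ?_ ?_)
    · exact isOpen_lt continuous_const (by fun_prop)
    · exact isOpen_lt continuous_const (by fun_prop)
  have hcont : Filter.Tendsto (fun τ : ℝ => z + τ • d) (𝓝[>] 0) (𝓝 z) := by
    have : Continuous (fun τ : ℝ => z + τ • d) := by fun_prop
    have h := this.tendsto 0
    simp only [zero_smul, add_zero] at h
    exact h.mono_left nhdsWithin_le_nhds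
  have hev := hcont.eventually ((hU.inter Metric.isOpen_ball).mem_nhds
    ⟨hz, Metric.mem_ball_self hη⟩)
  obtain ⟨τ, hτ, hτ0⟩ := (hev.and self_mem_nhdsWithin).exists
  have hτ0 : 0 < τ := hτ0
  have hVne : V.Nonempty := by
    refine ⟨z + τ • d, hτ, ?_, ?_⟩
    · simp only [Set.mem_ofPred_eq, add_sub_cancel_left, inner_smul_right, hd1]
      have := mul_self_pos.2 hs
      nlinarith
    · simp only [Set.mem_ofPred_eq, add_sub_cancel_left, inner_smul_right, hd2]
      have := mul_self_pos.2 ht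
      nlinarith
  obtain ⟨q, hq, hqV⟩ := H.inter_nonempty hVo (fun q hq => hUΩ hq.1.1) hVne
  exact ⟨q, hq, hqV.1.1, by simpa [dist_eq_norm] using hqV.1.2, hqV.2.1, hqV.2.2⟩

theorem cross_ne_zero_of_orthogonal {e f d d' : Plane} (he : ‖e‖ = 1) (hf : ‖f‖ = 1)
    (h1 : ⟪e, d⟫ = 0) (h2 : ⟪f, d'⟫ = 0) (h : planeCross d d' ≠ 0) : planeCross e f ≠ 0 := by
  have e2 := plane_norm_sq e
  have f2 := plane_norm_sq f
  rw [he] at e2; rw [hf] at f2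
  rw [plane_inner] at h1 h2
  unfold planeCross at *
  intro h0
  apply h
  -- `e = ± f`, so `e` is orthogonal to both vectors
  have h3 : e 0 * d' 0 + e 1 * d' 1 = 0 := by
    linear_combination (e 0 * d' 0 + e 1 * d' 1) * f2 + (e 0 * f 0 + e 1 * f 1) * h2
      - (f 0 * d' 1 - f 1 * d' 0) * h0
  linear_combination (d 0 * d' 1 - d 1 * d' 0) * e2 + (e 0 * d' 1 - e 1 * d' 0) * h1
      - (e 0 * d 1 - e 1 * d 0) * h3

/-- A third characteristic must pass through the crossing point. Otherwise put `q` near `z`, in the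
sector where the sign rules of `x` and `y` bound the components of `m q` along `a • (x - z)` and `b
• (y - z)` from one side; the rule of `w` bounds their sum from the other side. Both components are
then O(`‖q - z‖`), impossible for a unit vector and independent directions as `q` tends to `z`. -/
theorem Crosses.inner_eq_zero (H : IsCharacteristicField Ω D m) (hU : IsOpen U) (hc : Convex ℝ U)
    (hUΩ : U ⊆ Ω) {x y z w : Plane} (hz : z ∈ U) (hX : Crosses D m U z x y) (hw : w ∈ D)
    (hwU : w ∈ U) (hwx : planeCross (w - z) (x - z) ≠ 0) (hwy : planeCross (w - z) (y - z) ≠ 0) :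
    ⟪m w, w - z⟫ = 0 := by
  by_contra hne
  obtain ⟨⟨hx, hxU, hy, hyU⟩, hleft, hright, htr⟩ := hX
  have hmxy : planeCross (m x) (m y) ≠ 0 :=
    cross_ne_zero_of_orthogonal (H.norm_eq_one x hx) (H.norm_eq_one y hy) hleft hright htr
  set κ := ⟪m w, w - z⟫ with hκ
  set T := planeCross (x - z) (y - z) with hT
  -- `w - z = a (x - z) + b (y - z)`
  set a := planeCross (w - z) (y - z) / T with ha
  set b := -planeCross (w - z) (x - z) / T with hb
  have ha0 : a ≠ 0 := div_ne_zero hwy htr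
  have hb0 : b ≠ 0 := div_ne_zero (neg_ne_zero.2 hwx) htr
  have hdec : w - z = a • (x - z) + b • (y - z) := by
    have h : ∀ i, T * (w - z) i = planeCross (w - z) (y - z) * (x - z) i
        + -planeCross (w - z) (x - z) * (y - z) i := by
      intro i; rw [hT]; unfold planeCross; fin_cases i <;> simp <;> ring
    ext i
    simp only [PiLp.add_apply, PiLp.smul_apply, smul_eq_mul, ha, hb]
    rw [div_mul_eq_mul_div, div_mul_eq_mul_div, ← add_div, eq_div_iff htr, ← h i]; ring
  -- a point `q` of a suitable sector, so close to `z` that the sign rules conflict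
  set M := (1 + |a| + |b|) * (1 / |a| + 1 / |b|) with hM
  have hM0 : 0 ≤ M := by positivity
  obtain ⟨η, hη, hη1, hη2⟩ : ∃ η : ℝ, 0 < η ∧ η < |κ| ∧ η * (M * (‖x - z‖ + ‖y - z‖)) < |T| := by
    have hN0 : 0 ≤ M * (‖x - z‖ + ‖y - z‖) := by positivity
    have hTpos : 0 < |T| := abs_pos.2 htr
    have hκpos : 0 < |κ| := abs_pos.2 hne
    generalize M * (‖x - z‖ + ‖y - z‖) = N at hN0 ⊢
    refine ⟨min (|κ| / 2) (|T| / (2 * (N + 1))), by positivity, ?_, ?_⟩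
    · exact (min_le_left _ _).trans_lt (by linarith)
    · calc min (|κ| / 2) (|T| / (2 * (N + 1))) * N ≤ |T| / (2 * (N + 1)) * N :=
            mul_le_mul_of_nonneg_right (min_le_right _ _) hN0
        _ < |T| := by
            rw [div_mul_eq_mul_div, div_lt_iff₀ (by positivity)]; nlinarith
  obtain ⟨q, hq, hqU, hqz, hs, ht⟩ := H.exists_mem_sector hU hUΩ hz hmxy (κ * a) (κ * b)
    (mul_ne_zero hne ha0) (mul_ne_zero hne hb0) hη
  have seg : ∀ p ∈ U, segment ℝ p q ⊆ Ω := fun p hp => (hc.segment_subset hp hqU).trans hUΩ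
  have sx := H.sign x hx q hq (seg x hxU)
  have sy := H.sign y hy q hq (seg y hyU)
  have sw := H.sign w hw q hq (seg w hwU)
  have split : ∀ p p' : Plane, ⟪p, q - p'⟫ = ⟪p, q - z⟫ - ⟪p, p' - z⟫ := by
    intro p p'; rw [← inner_sub_right]; congr 1; abel
  have hmq := H.norm_eq_one q hq
  have bq : |⟪m q, q - z⟫| ≤ ‖q - z‖ := by
    simpa [hmq] using abs_real_inner_le_norm (m q) (q - z)
  have bw : |⟪m w, q - z⟫| ≤ ‖q - z‖ := by
    simpa [H.norm_eq_one w hw] using abs_real_inner_le_norm (m w) (q - z)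
  rw [split (m x), split (m q), hleft, sub_zero] at sx
  rw [split (m y), split (m q), hright, sub_zero] at sy
  have hww : ⟪m q, w - z⟫ = a * ⟪m q, x - z⟫ + b * ⟪m q, y - z⟫ := by
    rw [hdec, inner_add_right, inner_smul_right, inner_smul_right]
  rw [split (m w), split (m q), ← hκ, hww] at sw
  have x1 := mul_nonneg_of_sign hs sx
  have y1 := mul_nonneg_of_sign ht sy
  have w1 : 0 ≤ -κ * (⟪m q, q - z⟫ - (a * ⟪m q, x - z⟫ + b * ⟪m q, y - z⟫)) := by
    refine mul_nonneg_of_sign (p := ⟪m w, q - z⟫ - κ) ?_ sw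
    have hκpos : 0 < |κ| := abs_pos.2 hne
    have h1 : κ * ⟪m w, q - z⟫ ≤ |κ| * ‖q - z‖ := by
      calc κ * ⟪m w, q - z⟫ ≤ |κ * ⟪m w, q - z⟫| := le_abs_self _
        _ = |κ| * |⟪m w, q - z⟫| := abs_mul _ _
        _ ≤ |κ| * ‖q - z‖ := mul_le_mul_of_nonneg_left bw hκpos.le
    have h2 : |κ| * ‖q - z‖ < |κ| * |κ| := mul_lt_mul_of_pos_left (hqz.trans hη1) hκpos
    rw [abs_mul_abs_self] at h2
    linarith
  have bX : |⟪m q, x - z⟫| ≤ M * ‖q - z‖ := sector_bound hne ha0 bq x1 y1 w1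
  have bY : |⟪m q, y - z⟫| ≤ M * ‖q - z‖ := by
    rw [add_comm (a * _)] at w1
    have := sector_bound hne hb0 bq y1 x1 w1
    rwa [add_right_comm, add_comm (1 / |b|)] at this
  have hT1 : |T| ≤ η * (M * (‖x - z‖ + ‖y - z‖)) :=
    calc |T| ≤ |⟪m q, x - z⟫| * ‖y - z‖ + |⟪m q, y - z⟫| * ‖x - z‖ := abs_cross_le hmq
      _ ≤ M * ‖q - z‖ * ‖y - z‖ + M * ‖q - z‖ * ‖x - z‖ := by gcongr
      _ = ‖q - z‖ * (M * (‖x - z‖ + ‖y - z‖)) := by ring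
      _ ≤ η * (M * (‖x - z‖ + ‖y - z‖)) := by gcongr
  linarith

end IsCharacteristicField

/-! ### Vortices, and the Lipschitz estimate without crossings -/

/-- The vortex field of sign `α` centred at `z`. -/
noncomputable def vortex (α : ℝ) (z w : Plane) : Plane := (α / ‖w - z‖) • perp (w - z)

theorem inner_perp (x y : Plane) : ⟪perp x, y⟫ = planeCross x y := by
  rw [plane_inner]; simp [planeCross]; ring

theorem planeCross_swap (x y : Plane) : planeCross x y = -planeCross y x := by unfold planeCross; ring

theorem planeCross_self (x : Plane) : planeCross x x = 0 := by unfold planeCross; ring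

theorem planeCross_zero_left (x : Plane) : planeCross 0 x = 0 := by simp [planeCross]

theorem planeCross_sub_right (x y z : Plane) : planeCross x (y - z) = planeCross x y - planeCross x z := by
  simp [planeCross]; ring

theorem inner_vortex (α : ℝ) (z w : Plane) : ⟪vortex α z w, w - z⟫ = 0 := by
  rw [vortex, real_inner_smul_left, inner_perp_self, mul_zero]

theorem perp_eq_linear : ∃ J : Plane →ₗ[ℝ] Plane, ∀ x, J x = perp x :=
  ⟨{ toFun := perp
     map_add' := fun x y => plane_ext (by simp; ring) (by simp)
     map_smul' := fun c x => plane_ext (by simp) (by simp) }, fun _ => rfl⟩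

theorem contDiffAt_vortex (α : ℝ) {z x : Plane} (h : x ≠ z) : ContDiffAt ℝ 1 (vortex α z) x := by
  obtain ⟨J, hJ⟩ := perp_eq_linear
  have h1 : ContDiffAt ℝ 1 (fun w => J.toContinuousLinearMap (w - z)) x :=
    (J.toContinuousLinearMap.contDiff.comp (contDiff_id.sub contDiff_const)).contDiffAt
  have h2 : ContDiffAt ℝ 1 (fun w : Plane => α / ‖w - z‖) x :=
    contDiffAt_const.div ((contDiffAt_id.sub contDiffAt_const).norm ℝ (sub_ne_zero.2 h))
      (norm_ne_zero_iff.2 (sub_ne_zero.2 h))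
  refine (h2.smul h1).congr_of_eventuallyEq (Filter.Eventually.of_forall fun w => ?_)
  simp [vortex, hJ]

namespace IsCharacteristicField

variable {Ω D U : Set Plane} {m : Plane → Plane}

/-- Finitely many lines through `z` can be removed one at a time, each leaving a nonempty open set,
which the dense set `D` still meets. -/
theorem exists_mem_cross_ne_zero (H : IsCharacteristicField Ω D m) (z : Plane) (l : List Plane)
    (hl : ∀ d ∈ l, d ≠ 0) {V : Set Plane} (hV : IsOpen V) (hVΩ : V ⊆ Ω) (hne : V.Nonempty) :
    ∃ q ∈ D, q ∈ V ∧ ∀ d ∈ l, planeCross (q - z) d ≠ 0 := by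
  induction l generalizing V with
  | nil =>
    obtain ⟨q, hq, hqV⟩ := H.inter_nonempty hV hVΩ hne
    exact ⟨q, hq, hqV, by simp⟩
  | cons d l ih =>
    have hd : d ≠ 0 := hl d (by simp)
    have hcont : Continuous fun q : Plane => planeCross (q - z) d := by
      unfold planeCross; fun_prop
    have hW : IsOpen (V ∩ {q | planeCross (q - z) d ≠ 0}) :=
      hV.inter (isOpen_ne_fun hcont continuous_const)
    have hWne : (V ∩ {q | planeCross (q - z) d ≠ 0}).Nonempty := by
      obtain ⟨p, hp⟩ := hne
      by_cases h0 : planeCross (p - z) d = 0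
      · have ht : Filter.Tendsto (fun τ : ℝ => p + τ • perp d) (𝓝[>] 0) (𝓝 p) := by
          have hc : Continuous (fun τ : ℝ => p + τ • perp d) := by fun_prop
          have h := hc.tendsto 0
          simp only [zero_smul, add_zero] at h
          exact h.mono_left nhdsWithin_le_nhds
        obtain ⟨τ, hτ, hτ0⟩ := ((ht.eventually (hV.mem_nhds hp)).and self_mem_nhdsWithin).exists
        have hτ0 : 0 < τ := hτ0
        refine ⟨_, hτ, ?_⟩
        have : planeCross (p + τ • perp d - z) d = -τ * ‖d‖ ^ 2 := by
          rw [plane_norm_sq]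
          unfold planeCross at h0 ⊢
          simp at h0 ⊢
          linear_combination h0
        simp only [Set.mem_ofPred_eq, this]
        have : 0 < ‖d‖ := norm_pos_iff.2 hd
        have := mul_pos hτ0 (pow_pos this 2)
        linarith
      · exact ⟨p, hp, h0⟩
    obtain ⟨q, hq, hqV, hql⟩ := ih (fun d' hd' => hl d' (by simp [hd'])) hW
      (fun q hq => hVΩ hq.1) hWne
    refine ⟨q, hq, hqV.1, ?_⟩
    intro d' hd'
    rcases List.mem_cons.1 hd' with rfl | h
    · exact hqV.2
    · exact hql d' h

/-- The components along `y - x` of the two vortex fields are positive multiples of `α * T` and `β *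
T`, with `T` the common cross product, so the sign rule forces `α * β ≥ 0`. -/
theorem vortex_sign_eq (H : IsCharacteristicField Ω D m) (hc : Convex ℝ U) (hUΩ : U ⊆ Ω)
    {x y z : Plane} (hx : x ∈ D) (hxU : x ∈ U) (hy : y ∈ D) (hyU : y ∈ U) {α β : ℝ}
    (hα : α = 1 ∨ α = -1) (hβ : β = 1 ∨ β = -1) (hmx : m x = vortex α z x)
    (hmy : m y = vortex β z y) (h : planeCross (x - z) (y - z) ≠ 0) : α = β := by
  have hs := H.sign x hx y hy ((hc.segment_subset hxU hyU).trans hUΩ)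
  have hxz : x - z ≠ 0 := by intro h0; rw [h0, planeCross_zero_left] at h; exact h rfl
  have hyz : y - z ≠ 0 := by
    intro h0; rw [h0, planeCross_swap, planeCross_zero_left, neg_zero] at h; exact h rfl
  have e1 : ⟪m x, y - x⟫ = α / ‖x - z‖ * planeCross (x - z) (y - z) := by
    rw [hmx, vortex, real_inner_smul_left, inner_perp, show y - x = (y - z) - (x - z) by abel,
      planeCross_sub_right, planeCross_self, sub_zero]
  have e2 : ⟪m y, y - x⟫ = β / ‖y - z‖ * planeCross (x - z) (y - z) := by
    rw [hmy, vortex, real_inner_smul_left, inner_perp, show y - x = (y - z) - (x - z) by abel,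
      planeCross_sub_right, planeCross_self, zero_sub, ← planeCross_swap]
  rw [e1, e2] at hs
  set T := planeCross (x - z) (y - z)
  have p1 : 0 < ‖x - z‖ := norm_pos_iff.2 hxz
  have p2 : 0 < ‖y - z‖ := norm_pos_iff.2 hyz
  have hs' : 0 ≤ α * β * (T ^ 2 / (‖x - z‖ * ‖y - z‖)) := by
    have : α / ‖x - z‖ * T * (β / ‖y - z‖ * T) = α * β * (T ^ 2 / (‖x - z‖ * ‖y - z‖)) := by
      field_simp
    rwa [this] at hs
  have p3 : 0 < T ^ 2 / (‖x - z‖ * ‖y - z‖) := by positivity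
  have p4 : 0 ≤ α * β := nonneg_of_mul_nonneg_left hs' p3
  rcases hα with rfl | rfl <;> rcases hβ with rfl | rfl <;> first | rfl | norm_num at p4

/-- If two characteristics in a convex set cross, the field is a vortex there. -/
theorem Crosses.eq_vortex (H : IsCharacteristicField Ω D m) (hU : IsOpen U) (hc : Convex ℝ U)
    (hUΩ : U ⊆ Ω) {x y z : Plane} (hz : z ∈ U) (hX : Crosses D m U z x y) :
    ∃ α : ℝ, (α = 1 ∨ α = -1) ∧ ∀ w ∈ D, w ∈ U → w ≠ z → m w = vortex α z w := by
  have hxz : x - z ≠ 0 := by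
    intro h0; have := hX.transversal; rw [h0, planeCross_zero_left] at this; exact this rfl
  have hyz : y - z ≠ 0 := by
    intro h0; have := hX.transversal
    rw [h0, planeCross_swap, planeCross_zero_left, neg_zero] at this; exact this rfl
  have orth : ∀ w ∈ D, w ∈ U → w ≠ z → ⟪m w, w - z⟫ = 0 := by
    intro w hw hwU hwz
    have hwz' := sub_ne_zero.2 hwz
    -- `Crosses.inner_eq_zero` says nothing about points on the lines joining `z` to `x` or `y`.
    -- Since `w` may lie on one, the crossing pair is first replaced by one in general position with
    -- respect to `w`.
    obtain ⟨x', hx', hxU', hcx⟩ := H.exists_mem_cross_ne_zero z [x - z, y - z, w - z]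
      (by simp [hxz, hyz, hwz']) hU hUΩ ⟨z, hz⟩
    simp only [List.mem_cons, List.not_mem_nil, or_false, forall_eq_or_imp, forall_eq] at hcx
    have hxz' : x' - z ≠ 0 := by
      intro h0; have := hcx.1; rw [h0, planeCross_zero_left] at this; exact this rfl
    obtain ⟨y', hy', hyU', hcy⟩ := H.exists_mem_cross_ne_zero z [x - z, y - z, w - z, x' - z]
      (by simp [hxz, hyz, hwz', hxz']) hU hUΩ ⟨z, hz⟩
    simp only [List.mem_cons, List.not_mem_nil, or_false, forall_eq_or_imp, forall_eq] at hcy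
    have hX' : Crosses D m U z x' y' :=
      ⟨⟨hx', hxU', hy', hyU'⟩, hX.inner_eq_zero H hU hc hUΩ hz hx' hxU' hcx.1 hcx.2.1,
        hX.inner_eq_zero H hU hc hUΩ hz hy' hyU' hcy.1 hcy.2.1,
        by rw [planeCross_swap]; exact neg_ne_zero.2 hcy.2.2.2⟩
    exact hX'.inner_eq_zero H hU hc hUΩ hz hw hwU
      (by rw [planeCross_swap]; exact neg_ne_zero.2 hcx.2.2)
      (by rw [planeCross_swap]; exact neg_ne_zero.2 hcy.2.2.1)
  have ex : ∀ w ∈ D, w ∈ U → w ≠ z → ∃ α : ℝ, (α = 1 ∨ α = -1) ∧ m w = vortex α z w :=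
    fun w hw hwU hwz => eq_perp_of_inner_eq_zero (H.norm_eq_one w hw) (sub_ne_zero.2 hwz)
      (orth w hw hwU hwz)
  obtain ⟨hx, hxU, -, -⟩ := hX.mem
  obtain ⟨α, hα, hmx⟩ := ex x hx hxU (sub_ne_zero.1 hxz)
  refine ⟨α, hα, fun w hw hwU hwz => ?_⟩
  obtain ⟨β, hβ, hmw⟩ := ex w hw hwU hwz
  -- `x` and `w` may be collinear with `z`, so their signs are compared through a third point.
  obtain ⟨q, hq, hqU, hcq⟩ := H.exists_mem_cross_ne_zero z [x - z, w - z]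
    (by simp [hxz, sub_ne_zero.2 hwz]) hU hUΩ ⟨z, hz⟩
  simp only [List.mem_cons, List.not_mem_nil, or_false, forall_eq_or_imp, forall_eq] at hcq
  have hqz : q ≠ z := by
    rintro rfl; have := hcq.1; rw [sub_self, planeCross_zero_left] at this; exact this rfl
  obtain ⟨γ, hγ, hmq⟩ := ex q hq hqU hqz
  have h1 := H.vortex_sign_eq hc hUΩ hq hqU hx hxU hγ hα hmq hmx hcq.1
  have h2 := H.vortex_sign_eq hc hUΩ hq hqU hw hwU hγ hβ hmq hmw hcq.2
  rw [← h1, h2, hmw]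

/-- At a point `w` off the line through `z` and `z'`, a unit vector would be orthogonal to the
independent vectors `w - z` and `w - z'`. -/
theorem center_unique (H : IsCharacteristicField Ω D m) {V : Set Plane} (hV : IsOpen V)
    (hVΩ : V ⊆ Ω) (hne : V.Nonempty) {z z' : Plane}
    (h : ∀ w ∈ D, w ∈ V → w ≠ z → ⟪m w, w - z⟫ = 0)
    (h' : ∀ w ∈ D, w ∈ V → w ≠ z' → ⟪m w, w - z'⟫ = 0) : z = z' := by
  by_contra hzz
  obtain ⟨w, hw, hwV, hcw⟩ := H.exists_mem_cross_ne_zero z [z' - z]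
    (by simp [sub_ne_zero.2 (Ne.symm hzz)]) hV hVΩ hne
  simp only [List.mem_cons, List.not_mem_nil, or_false, forall_eq] at hcw
  have e : planeCross (w - z) (w - z') = -planeCross (w - z) (z' - z) := by unfold planeCross; simp; ring
  have h1 : w ≠ z := by rintro rfl; simp [planeCross] at hcw
  have h2 : w ≠ z' := by rintro rfl; rw [planeCross_self] at hcw; exact hcw rfl
  have := abs_cross_le (p := w - z) (q := w - z') (H.norm_eq_one w hw)
  rw [h w hw hwV h1, h' w hw hwV h2, e, abs_neg] at this
  rw [abs_zero, zero_mul, zero_mul, add_zero] at this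
  exact (abs_pos.2 hcw).not_ge this

/-- Here `e`, `f` are the field at two points and `d` their difference; `hσ` says that the
characteristics meet at distance at least `R / 2`, if at all. It bounds the sine `σ` of the angle by
`2 * ‖d‖ / R`. In `t = s * c + r * σ` the last term is smaller than `|t|`, so equal signs of `s`,
`t` give a positive cosine `c`. Then `2 - 2 * c ≤ 2 * σ ^ 2`, and the constant 3 absorbs `√8`. -/
theorem norm_sub_le_of_abs_cross_le {e f d : Plane} {R : ℝ} (hR : 0 < R) (he : ‖e‖ = 1)
    (hf : ‖f‖ = 1) (hst : 0 < ⟪e, d⟫ * ⟪f, d⟫) (hd : ‖d‖ < R / 2)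
    (hσ : |planeCross e f| * (R / 2) ≤ |⟪f, d⟫|) : ‖e - f‖ ≤ 3 / R * ‖d‖ := by
  set s := ⟪e, d⟫ with hs
  set t := ⟪f, d⟫ with ht
  set σ := planeCross e f with hσdef
  set c := ⟪e, f⟫ with hc
  set r := planeCross e d with hr
  have e2 := plane_norm_sq e
  have f2 := plane_norm_sq f
  rw [he] at e2; rw [hf] at f2
  have hts : t = s * c + r * σ := by
    rw [ht, hs, hc, hr, hσdef, plane_inner, plane_inner, plane_inner]; unfold planeCross
    linear_combination (f 0 * d 0 + f 1 * d 1) * e2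
  have hcσ : c ^ 2 + σ ^ 2 = 1 := by
    rw [hc, hσdef, plane_inner]; unfold planeCross
    linear_combination (-(f 0 ^ 2 + f 1 ^ 2)) * e2 - f2
  have ht' : |t| ≤ ‖d‖ := by simpa [hf] using abs_real_inner_le_norm f d
  have hr' : |r| ≤ ‖d‖ := by
    rw [hr, ← inner_perp]
    simpa [norm_perp, he] using abs_real_inner_le_norm (perp e) d
  have htpos : 0 < |t| := abs_pos.2 (by rintro h0; rw [h0] at hst; simp at hst)
  have hrσ : |r * σ| < |t| := by
    rw [abs_mul]
    rcases eq_or_ne σ 0 with h0 | h0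
    · rw [h0]; simpa using htpos
    · have : 0 < |σ| := abs_pos.2 h0
      nlinarith
  have hcpos : 0 < c := by
    have h1 : t * (r * σ) < t ^ 2 := by
      calc t * (r * σ) ≤ |t| * |r * σ| := by rw [← abs_mul]; exact le_abs_self _
        _ < |t| * |t| := mul_lt_mul_of_pos_left hrσ htpos
        _ = t ^ 2 := by rw [abs_mul_abs_self]; ring
    have h2 : 0 < (s * t) * c := by
      have : (s * t) * c = t ^ 2 - t * (r * σ) := by rw [hts]; ring
      linarith
    exact (mul_pos_iff_of_pos_left hst).1 h2
  have hn : ‖e - f‖ ^ 2 = 2 - 2 * c := by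
    rw [norm_sub_sq_real, he, hf]; ring
  have hσd : |σ| ≤ 2 * ‖d‖ / R := by
    rw [le_div_iff₀ hR]; linarith
  have hle : ‖e - f‖ ^ 2 ≤ (3 / R * ‖d‖) ^ 2 := by
    have h1 : σ ^ 2 ≤ (2 * ‖d‖ / R) ^ 2 := by
      rw [← sq_abs σ]; exact pow_le_pow_left₀ (abs_nonneg _) hσd 2
    have h2 : (3 / R * ‖d‖) ^ 2 = 9 * (‖d‖ / R) ^ 2 := by ring
    have h3 : (2 * ‖d‖ / R) ^ 2 = 4 * (‖d‖ / R) ^ 2 := by ring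
    have h4 : c ≤ 1 := by nlinarith [sq_nonneg σ]
    nlinarith [sq_nonneg (‖d‖ / R)]
  exact (sq_le_sq₀ (norm_nonneg _) (by positivity)).1 hle

/-- If no two characteristics cross in a ball, the field is Lipschitz near its centre. -/
theorem norm_sub_le_of_not_crosses (H : IsCharacteristicField Ω D m) {c : Plane} {R : ℝ}
    (hR : 0 < R) (hball : Metric.ball c R ⊆ Ω)
    (hno : ∀ z ∈ Metric.ball c R, ∀ x y, ¬ Crosses D m (Metric.ball c R) z x y)
    {x y : Plane} (hx : x ∈ D) (hxc : x ∈ Metric.ball c (R / 4)) (hy : y ∈ D)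
    (hyc : y ∈ Metric.ball c (R / 4)) : ‖m x - m y‖ ≤ 3 / R * ‖x - y‖ := by
  have hsub : Metric.ball c (R / 4) ⊆ Metric.ball c R := Metric.ball_subset_ball (by linarith)
  have main : ∀ y ∈ D, y ∈ Metric.ball c (R / 4) → ⟪m x, y - x⟫ ≠ 0 →
      ‖m x - m y‖ ≤ 3 / R * ‖x - y‖ := by
    intro y hy hyc hs
    have ht : ⟪m y, y - x⟫ ≠ 0 := by
      intro h0
      apply hs
      have := H.inner_eq_zero Metric.isOpen_ball (convex_ball c R) hball hy (hsub hyc) hx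
        (hsub hxc) (by rw [← neg_sub, inner_neg_right, h0, neg_zero])
      rw [← neg_sub, inner_neg_right, this, neg_zero]
    have hst := H.sign x hx y hy
      (((convex_ball c R).segment_subset (hsub hxc) (hsub hyc)).trans hball)
    have hst' : 0 < ⟪m x, y - x⟫ * ⟪m y, y - x⟫ :=
      lt_of_le_of_ne hst (Ne.symm (mul_ne_zero hs ht))
    rw [norm_sub_rev x y]
    have hxy : ‖y - x‖ < R / 2 := by
      rw [← dist_eq_norm]
      have h1 := dist_triangle_right y x c
      rw [Metric.mem_ball] at hxc hyc
      linarith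
    refine norm_sub_le_of_abs_cross_le hR (H.norm_eq_one x hx) (H.norm_eq_one y hy) hst' hxy ?_
    by_cases hσ : planeCross (m x) (m y) = 0
    · rw [hσ]; simp
    -- `x + τ • perp (m x)` is the intersection of the two characteristics. Without crossings it
    -- lies outside the large ball, hence farther than `R / 2` from `x`.
    set τ := ⟪m y, y - x⟫ / planeCross (m x) (m y) with hτ
    have hnotin : x + τ • perp (m x) ∉ Metric.ball c R := by
      intro hin
      refine hno _ hin x y ⟨⟨hx, hsub hxc, hy, hsub hyc⟩, ?_, ?_, ?_⟩
      · rw [sub_add_cancel_left, inner_neg_right, inner_smul_right, real_inner_comm,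
          inner_perp_self]; simp
      · rw [← sub_sub, inner_sub_right, inner_smul_right, real_inner_comm (perp (m x)) (m y),
          inner_perp, hτ, div_mul_cancel₀ _ hσ, sub_self]
      · have : planeCross (x - (x + τ • perp (m x))) (y - (x + τ • perp (m x)))
            = τ * ⟪m x, y - x⟫ := by
          rw [plane_inner]; unfold planeCross; simp; ring
        rw [this]
        exact mul_ne_zero (div_ne_zero ht hσ) hs
    have h1 : R ≤ dist (x + τ • perp (m x)) c := by simpa using hnotin
    have h2 := dist_triangle (x + τ • perp (m x)) x c
    have h3 : dist (x + τ • perp (m x)) x = |τ| := by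
      rw [dist_eq_norm, add_sub_cancel_left, norm_smul, norm_perp, H.norm_eq_one x hx, mul_one]; rfl
    rw [Metric.mem_ball] at hxc
    have h4 : R / 2 ≤ |τ| := by linarith
    have h5 : |⟪m y, y - x⟫| = |planeCross (m x) (m y)| * |τ| := by
      rw [hτ, abs_div, mul_div_cancel₀ _ (abs_ne_zero.2 hσ)]
    rw [h5]
    exact mul_le_mul_of_nonneg_left h4 (abs_nonneg _)
  by_cases hs : ⟪m x, y - x⟫ = 0
  -- When `y` lies on the characteristic of `x` the sign rule is not strict; `y` is approximated by
  -- points `y'` off that line.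
  · refine le_of_forall_pos_le_add fun ε hε => ?_
    obtain ⟨r, hr, hrb⟩ := Metric.isOpen_iff.1 Metric.isOpen_ball y hyc
    have hmx : m x ≠ 0 := by
      intro h0; have := H.norm_eq_one x hx; rw [h0] at this; simp at this
    obtain ⟨y', hy', hyy, hmy, hey⟩ := H.approx y hy (m x) hmx (min r (ε / (3 / R + 1)))
      (lt_min hr (by positivity))
    have hyb : y' ∈ Metric.ball c (R / 4) :=
      hrb (by rw [mem_ball_iff_norm]; exact hyy.trans_le (min_le_left _ _))
    have hs' : ⟪m x, y' - x⟫ ≠ 0 := by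
      rw [show y' - x = (y' - y) + (y - x) by abel, inner_add_right, hs, add_zero]; exact hey.ne'
    have h1 := main y' hy' hyb hs'
    have h2 : ‖x - y'‖ ≤ ‖x - y‖ + ‖y' - y‖ := by
      rw [show x - y' = (x - y) - (y' - y) by abel]; exact norm_sub_le _ _
    have h3 : ‖m x - m y‖ ≤ ‖m x - m y'‖ + ‖m y' - m y‖ := by
      rw [show m x - m y = (m x - m y') + (m y' - m y) by abel]; exact norm_add_le _ _
    have h4 := (hyy.trans_le (min_le_right _ _)).le
    have h5 := (hmy.trans_le (min_le_right _ _)).le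
    have h6 : (3 / R + 1) * (ε / (3 / R + 1)) = ε := by field_simp
    have h7 : 0 < 3 / R := by positivity
    nlinarith
  · exact main y hy hyc hs

end IsCharacteristicField

/-! ### The vortex set and regularity of the continuous extension -/

namespace IsCharacteristicField

variable {Ω D U : Set Plane} {m : Plane → Plane}

/-- The points around which the field is a vortex. -/
def vortexSet (Ω D : Set Plane) (m : Plane → Plane) : Set Plane :=
  {P | P ∈ Ω ∧ ∃ α : ℝ, (α = 1 ∨ α = -1) ∧ ∃ r > 0, Metric.ball P r ⊆ Ω ∧
    ∀ w ∈ D, w ∈ Metric.ball P r → w ≠ P → m w = vortex α P w}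

theorem exists_crosses_of_mem_vortexSet (H : IsCharacteristicField Ω D m) {P : Plane}
    (hP : P ∈ vortexSet Ω D m) (hU : IsOpen U) (hPU : P ∈ U) :
    ∃ x y, Crosses D m U P x y := by
  obtain ⟨-, α, -, r, hr, hrΩ, hv⟩ := hP
  have hV : IsOpen (Metric.ball P r ∩ U) := Metric.isOpen_ball.inter hU
  have hVΩ : Metric.ball P r ∩ U ⊆ Ω := fun q hq => hrΩ hq.1
  have hne : (Metric.ball P r ∩ U).Nonempty := ⟨P, Metric.mem_ball_self hr, hPU⟩
  obtain ⟨x, hx, hxV, hcx⟩ := H.exists_mem_cross_ne_zero P [EuclideanSpace.single 0 1]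
    (by simp) hV hVΩ hne
  simp only [List.mem_cons, List.not_mem_nil, or_false, forall_eq] at hcx
  have hxP : x ≠ P := by
    rintro rfl; rw [sub_self, planeCross_zero_left] at hcx; exact hcx rfl
  obtain ⟨y, hy, hyV, hcy⟩ := H.exists_mem_cross_ne_zero P [x - P]
    (by simp [sub_ne_zero.2 hxP]) hV hVΩ hne
  simp only [List.mem_cons, List.not_mem_nil, or_false, forall_eq] at hcy
  have hyP : y ≠ P := by
    rintro rfl; rw [sub_self, planeCross_zero_left] at hcy; exact hcy rfl
  refine ⟨x, y, ⟨hx, hxV.2, hy, hyV.2⟩, ?_, ?_, ?_⟩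
  · rw [hv x hx hxV.1 hxP, inner_vortex]
  · rw [hv y hy hyV.1 hyP, inner_vortex]
  · rw [planeCross_swap]; exact neg_ne_zero.2 hcy

/-- By straightness, the field at a vortex centre in `D` would be orthogonal to two independent
directions. Hence the extension can agree with `m` on all of `D`. -/
theorem not_mem_vortexSet (H : IsCharacteristicField Ω D m) {x : Plane} (hx : x ∈ D) :
    x ∉ vortexSet Ω D m := by
  intro hP
  obtain ⟨-, -, -, r, hr, hrΩ, -⟩ := id hP
  obtain ⟨a, b, hX⟩ := H.exists_crosses_of_mem_vortexSet hP Metric.isOpen_ball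
    (Metric.mem_ball_self hr)
  obtain ⟨⟨ha, haU, hb, hbU⟩, h1, h2, h3⟩ := hX
  have flip : ∀ e p : Plane, ⟪e, p - x⟫ = 0 → ⟪e, x - p⟫ = 0 := by
    intro e p h; rw [← neg_sub, inner_neg_right, h, neg_zero]
  have flip' : ∀ e p : Plane, ⟪e, x - p⟫ = 0 → ⟪e, p - x⟫ = 0 := by
    intro e p h; rw [← neg_sub, inner_neg_right, h, neg_zero]
  have k1 := flip' _ _ (H.inner_eq_zero Metric.isOpen_ball (convex_ball x r) hrΩ ha haU hx
    (Metric.mem_ball_self hr) (flip _ _ h1))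
  have k2 := flip' _ _ (H.inner_eq_zero Metric.isOpen_ball (convex_ball x r) hrΩ hb hbU hx
    (Metric.mem_ball_self hr) (flip _ _ h2))
  have := abs_cross_le (p := a - x) (q := b - x) (H.norm_eq_one x hx)
  rw [k1, k2, abs_zero, zero_mul, zero_mul, add_zero] at this
  exact (abs_pos.2 h3).not_ge this

theorem vortexSet_locally_finite (H : IsCharacteristicField Ω D m) (hΩ : IsOpen Ω) {x : Plane}
    (hx : x ∈ Ω) : ∃ V ∈ 𝓝 x, (V ∩ vortexSet Ω D m).Finite := by
  obtain ⟨R, hR, hRΩ⟩ := Metric.isOpen_iff.1 hΩ x hx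
  refine ⟨Metric.ball x R, Metric.ball_mem_nhds x hR, ?_⟩
  -- A crossing at either centre makes the field a vortex about it in the whole ball, so two centres
  -- in one ball coincide.
  refine Set.Subsingleton.finite ?_
  rintro P ⟨hPb, hP⟩ Q ⟨hQb, hQ⟩
  obtain ⟨a, b, hX⟩ := H.exists_crosses_of_mem_vortexSet hP Metric.isOpen_ball hPb
  obtain ⟨a', b', hX'⟩ := H.exists_crosses_of_mem_vortexSet hQ Metric.isOpen_ball hQb
  obtain ⟨α, -, hα⟩ := hX.eq_vortex H Metric.isOpen_ball (convex_ball x R) hRΩ hPb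
  obtain ⟨β, -, hβ⟩ := hX'.eq_vortex H Metric.isOpen_ball (convex_ball x R) hRΩ hQb
  exact H.center_unique Metric.isOpen_ball hRΩ ⟨P, hPb⟩
    (fun w hw hwV hne => by rw [hα w hw hwV hne, inner_vortex])
    (fun w hw hwV hne => by rw [hβ w hw hwV hne, inner_vortex])

/-- Dichotomy in a ball about `x`: either characteristics cross, and the field is a vortex whose
centre is not `x`, smooth near `x`; or none cross and the quantitative estimate applies. -/
theorem exists_lipschitzOnWith (H : IsCharacteristicField Ω D m) (hΩ : IsOpen Ω) {x : Plane}
    (hx : x ∈ Ω) (hxS : x ∉ vortexSet Ω D m) :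
    ∃ r > 0, ∃ K, Metric.ball x r ⊆ Ω ∧ LipschitzOnWith K m (D ∩ Metric.ball x r) := by
  obtain ⟨R, hR, hRΩ⟩ := Metric.isOpen_iff.1 hΩ x hx
  by_cases hX : ∃ z ∈ Metric.ball x R, ∃ a b, Crosses D m (Metric.ball x R) z a b
  · obtain ⟨z, hz, a, b, hX⟩ := hX
    obtain ⟨α, hα, hv⟩ := hX.eq_vortex H Metric.isOpen_ball (convex_ball x R) hRΩ hz
    have hxz : x ≠ z := by
      rintro rfl
      exact hxS ⟨hx, α, hα, R, hR, hRΩ, hv⟩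
    obtain ⟨K, t, ht, hK⟩ := (contDiffAt_vortex α hxz).exists_lipschitzOnWith
    have ht' : t ∩ Metric.ball x R ∩ {z}ᶜ ∈ 𝓝 x :=
      Filter.inter_mem (Filter.inter_mem ht (Metric.ball_mem_nhds x hR))
        (isOpen_compl_singleton.mem_nhds hxz)
    obtain ⟨r, hr, hrt⟩ := Metric.mem_nhds_iff.1 ht'
    refine ⟨r, hr, K, fun q hq => hRΩ (hrt hq).1.2, ?_⟩
    intro p hp q hq
    rw [hv p hp.1 (hrt hp.2).1.2 (hrt hp.2).2, hv q hq.1 (hrt hq.2).1.2 (hrt hq.2).2]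
    exact hK (hrt hp.2).1.1 (hrt hq.2).1.1
  · push Not at hX
    refine ⟨R / 4, by positivity, (3 / R).toNNReal, ?_, ?_⟩
    · exact (Metric.ball_subset_ball (by linarith)).trans hRΩ
    · refine LipschitzOnWith.of_dist_le_mul fun p hp q hq => ?_
      rw [Real.coe_toNNReal _ (by positivity), dist_eq_norm, dist_eq_norm]
      exact H.norm_sub_le_of_not_crosses hR hRΩ hX hp.1 hp.2 hq.1 hq.2

theorem exists_lipschitzWith_extendFrom (H : IsCharacteristicField Ω D m) (hΩ : IsOpen Ω)
    {x : Plane} (hx : x ∈ Ω) (hxS : x ∉ vortexSet Ω D m) :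
    ∃ r > 0, ∃ K, ∃ g : Plane → Plane, Metric.ball x r ⊆ Ω ∧ LipschitzWith K g ∧
      (∀ y ∈ Metric.ball x r, extendFrom D m y = g y) ∧ ∀ y ∈ D, y ∈ Metric.ball x r → m y = g y := by
  obtain ⟨r, hr, K, hrΩ, hK⟩ := H.exists_lipschitzOnWith hΩ hx hxS
  obtain ⟨g, hg, hgm⟩ := hK.extend_finite_dimension
  refine ⟨r, hr, _, g, hrΩ, hg, fun y hy => ?_, fun y hyD hy => hgm ⟨hyD, hy⟩⟩
  refine extendFrom_eq (H.dense (hrΩ hy)) ?_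
  have h1 : Filter.Tendsto g (𝓝[D] y) (𝓝 (g y)) :=
    hg.continuous.continuousAt.mono_left nhdsWithin_le_nhds
  refine h1.congr' ?_
  filter_upwards [self_mem_nhdsWithin,
    nhdsWithin_le_nhds (Metric.isOpen_ball.mem_nhds hy)] with q hq hq'
  exact (hgm ⟨hq, hq'⟩).symm

theorem regularity (H : IsCharacteristicField Ω D m) (hΩ : IsOpen Ω) (hD : D ⊆ Ω) :
    ∃ (v : Plane → Plane) (S : Set Plane), (∀ x ∈ D, v x = m x) ∧ S ⊆ Ω ∧
      (∀ x ∈ Ω, ∃ V ∈ 𝓝 x, (V ∩ S).Finite) ∧ LocallyLipschitzOn (Ω \ S) v ∧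
      ∀ P ∈ S, ∃ α : ℝ, (α = 1 ∨ α = -1) ∧
        ∀ U : Set Plane, U ∈ 𝓝 P → Convex ℝ U → U ⊆ Ω →
          ∀ x ∈ U, x ≠ P → v x = (α / ‖x - P‖) • perp (x - P) := by
  refine ⟨extendFrom D m, vortexSet Ω D m, ?_, fun P hP => hP.1,
    fun x hx => H.vortexSet_locally_finite hΩ hx, ?_, ?_⟩
  · intro x hx
    obtain ⟨r, hr, K, g, -, -, h1, h2⟩ :=
      H.exists_lipschitzWith_extendFrom hΩ (hD hx) (H.not_mem_vortexSet hx)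
    rw [h1 x (Metric.mem_ball_self hr), h2 x hx (Metric.mem_ball_self hr)]
  · rintro x ⟨hx, hxS⟩
    obtain ⟨r, hr, K, g, -, hg, h1, -⟩ := H.exists_lipschitzWith_extendFrom hΩ hx hxS
    refine ⟨K, Metric.ball x r, nhdsWithin_le_nhds (Metric.ball_mem_nhds x hr), ?_⟩
    intro p hp q hq
    rw [h1 p hp, h1 q hq]
    exact hg p q
  · intro P hP
    obtain ⟨-, α, hα, r, hr, hrΩ, hv⟩ := id hP
    refine ⟨α, hα, fun U hUP hUc hUΩ x hxU hxP => ?_⟩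
    -- The crossing argument needs an open convex set, so it runs in the interior. The remaining
    -- points of `U` lie in the closure of the interior, by convexity, and are reached by
    -- continuity.
    have hIΩ : interior U ⊆ Ω := interior_subset.trans hUΩ
    have hPI : P ∈ interior U := mem_interior_iff_mem_nhds.2 hUP
    obtain ⟨a, b, hX⟩ := H.exists_crosses_of_mem_vortexSet hP isOpen_interior hPI
    obtain ⟨β, hβ, hvU⟩ := hX.eq_vortex H isOpen_interior hUc.interior hIΩ hPI
    have hαβ : α = β := by
      obtain ⟨w, hw, hwV, hcw⟩ := H.exists_mem_cross_ne_zero P [EuclideanSpace.single 0 1]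
        (by simp) (Metric.isOpen_ball.inter isOpen_interior) (fun q hq => hIΩ hq.2)
        ⟨P, Metric.mem_ball_self hr, hPI⟩
      simp only [List.mem_cons, List.not_mem_nil, or_false, forall_eq] at hcw
      have hwP : w ≠ P := by
        rintro rfl; rw [sub_self, planeCross_zero_left] at hcw; exact hcw rfl
      have h1 := (hv w hw hwV.1 hwP).symm.trans (hvU w hw hwV.2 hwP)
      have hn : ‖w - P‖ ≠ 0 := norm_ne_zero_iff.2 (sub_ne_zero.2 hwP)
      have hp : perp (w - P) ≠ 0 := by rw [← norm_ne_zero_iff, norm_perp]; exact hn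
      have h2 := smul_left_injective ℝ hp h1
      exact (div_left_inj' hn).1 h2
    subst hαβ
    have hxcl : x ∈ closure (interior U) := by
      rw [hUc.closure_interior_eq_closure_of_nonempty_interior ⟨P, hPI⟩]
      exact subset_closure hxU
    have hxS : x ∉ vortexSet Ω D m := by
      intro hxS
      obtain ⟨hxΩ, β', -, r', hr', hrΩ', hv'⟩ := hxS
      obtain ⟨q, hq⟩ := mem_closure_iff.1 hxcl _ Metric.isOpen_ball (Metric.mem_ball_self hr')
      exact hxP (H.center_unique (Metric.isOpen_ball.inter isOpen_interior)
        (fun q hq => hIΩ hq.2) ⟨q, hq⟩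
        (fun w hw hwV hne => by rw [hv' w hw hwV.1 hne, inner_vortex])
        (fun w hw hwV hne => by rw [hvU w hw hwV.2 hne, inner_vortex]))
    obtain ⟨r', hr', K, g, hrΩ', hg, h1, h2⟩ :=
      H.exists_lipschitzWith_extendFrom hΩ (hUΩ hxU) hxS
    rw [h1 x (Metric.mem_ball_self hr')]
    have hxcl' : x ∈ closure (D ∩ (Metric.ball x r' ∩ (interior U ∩ {P}ᶜ))) := by
      rw [mem_closure_iff]
      intro V hV hxV
      have hopen : IsOpen (V ∩ Metric.ball x r' ∩ {P}ᶜ) :=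
        (hV.inter Metric.isOpen_ball).inter isOpen_compl_singleton
      obtain ⟨q, hq, hqI⟩ := mem_closure_iff.1 hxcl _ hopen
        ⟨⟨hxV, Metric.mem_ball_self hr'⟩, hxP⟩
      obtain ⟨w, hw, hwV⟩ := H.inter_nonempty (hopen.inter isOpen_interior)
        (fun q hq => hIΩ hq.2) ⟨q, hq, hqI⟩
      exact ⟨w, hwV.1.1.1, hw, hwV.1.1.2, hwV.2, hwV.1.2⟩
    have : (𝓝[D ∩ (Metric.ball x r' ∩ (interior U ∩ {P}ᶜ))] x).NeBot :=
      mem_closure_iff_nhdsWithin_neBot.1 hxcl'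
    have t1 : Filter.Tendsto g (𝓝[D ∩ (Metric.ball x r' ∩ (interior U ∩ {P}ᶜ))] x) (𝓝 (g x)) :=
      hg.continuous.continuousAt.mono_left nhdsWithin_le_nhds
    have t2 : Filter.Tendsto (vortex α P) (𝓝[D ∩ (Metric.ball x r' ∩ (interior U ∩ {P}ᶜ))] x)
        (𝓝 (vortex α P x)) :=
      (contDiffAt_vortex α hxP).continuousAt.mono_left nhdsWithin_le_nhds
    refine tendsto_nhds_unique t1 (t2.congr' ?_)
    filter_upwards [self_mem_nhdsWithin] with w hw
    rw [← h2 w hw.1 hw.2.1, hvU w hw.1 hw.2.2.1 hw.2.2.2]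

end IsCharacteristicField

/-! ### Mollification and the defect of length -/

/-- `ρ` is a smooth mollifier at scale `ε`, with bounds of the natural order. -/
structure IsMollifier (C ε : ℝ) (ρ : Plane → ℝ) : Prop where
  smooth : ContDiff ℝ ∞ ρ
  nonneg : ∀ x, 0 ≤ ρ x
  support : tsupport ρ ⊆ Metric.closedBall 0 ε
  integral_eq_one : ∫ x, ρ x = 1
  le : ∀ x, ρ x ≤ C / ε ^ 2
  fderiv_le : ∀ x, ‖fderiv ℝ ρ x‖ ≤ C / ε ^ 3

/-- One bump rescaled, so that `C` does not depend on `ε`. -/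
theorem exists_isMollifier : ∃ C : ℝ, 0 < C ∧ ∀ ε : ℝ, 0 < ε → ∃ ρ, IsMollifier C ε ρ := by
  let φ : ContDiffBump (0 : Plane) := ⟨1 / 2, 1, by norm_num, by norm_num⟩
  set ψ : Plane → ℝ := φ.normed volume with hψ
  have hsm : ContDiff ℝ ∞ ψ := φ.contDiff_normed
  have hcs : HasCompactSupport ψ := φ.hasCompactSupport_normed
  have hsupp : tsupport ψ = Metric.closedBall 0 1 := φ.tsupport_normed_eq
  obtain ⟨C1, hC1⟩ := hsm.continuous.bounded_above_of_compact_support hcs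
  obtain ⟨C2, hC2⟩ := (hsm.continuous_fderiv (by simp)).bounded_above_of_compact_support
    (hcs.fderiv ℝ)
  refine ⟨max C1 C2 + 1, ?_, fun ε hε => ⟨fun x => (ε ^ 2)⁻¹ * ψ (ε⁻¹ • x), ?_, ?_, ?_, ?_, ?_, ?_⟩⟩
  · have := (norm_nonneg _).trans (hC1 0)
    have := le_max_left C1 C2
    linarith
  · exact contDiff_const.mul (hsm.comp (ε⁻¹ • ContinuousLinearMap.id ℝ Plane).contDiff)
  · intro x; exact mul_nonneg (by positivity) (φ.nonneg_normed _)
  · refine closure_minimal ?_ Metric.isClosed_closedBall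
    intro x hx
    have h1 : ψ (ε⁻¹ • x) ≠ 0 := right_ne_zero_of_mul hx
    have h2 : ε⁻¹ • x ∈ Metric.closedBall (0 : Plane) 1 := hsupp ▸ subset_tsupport ψ h1
    rw [mem_closedBall_zero_iff, norm_smul, norm_inv, Real.norm_of_nonneg hε.le] at h2
    rw [mem_closedBall_zero_iff]
    rwa [inv_mul_le_iff₀ hε, mul_one] at h2
  · rw [integral_const_mul, Measure.integral_comp_smul volume ψ, φ.integral_normed]
    simp
    field_simp
  · intro x
    rw [div_eq_inv_mul]
    have := (le_abs_self _).trans (hC1 (ε⁻¹ • x))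
    have := le_max_left C1 C2
    gcongr
    linarith
  · intro x
    have hd : HasFDerivAt (fun x => (ε ^ 2)⁻¹ * ψ (ε⁻¹ • x))
        ((ε ^ 2)⁻¹ • ((fderiv ℝ ψ (ε⁻¹ • x)).comp (ε⁻¹ • ContinuousLinearMap.id ℝ Plane))) x := by
      refine HasFDerivAt.const_mul ?_ _
      refine HasFDerivAt.comp x (hsm.differentiable (by simp) _).hasFDerivAt ?_
      exact (ε⁻¹ • ContinuousLinearMap.id ℝ Plane).hasFDerivAt
    rw [hd.fderiv, ContinuousLinearMap.comp_smul, ContinuousLinearMap.comp_id, norm_smul, norm_smul,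
      ← mul_assoc]
    have e : ‖(ε ^ 2)⁻¹‖ * ‖ε⁻¹‖ = (ε ^ 3)⁻¹ := by
      rw [norm_inv, norm_inv, norm_pow, Real.norm_of_nonneg hε.le]; field_simp
    rw [e, div_eq_inv_mul]
    have := hC2 (ε⁻¹ • x)
    have := le_max_right C1 C2
    gcongr
    linarith

/-- Mollification `x ↦ ∫ f(y) ρ(x - y) dy`. -/
noncomputable def mollify (ρ f : Plane → ℝ) (x : Plane) : ℝ := ∫ y, f y * ρ (x - y)

theorem mollify_eq_convolution (ρ f : Plane → ℝ) :
    mollify ρ f = convolution f ρ (ContinuousLinearMap.mul ℝ ℝ) volume := by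
  ext x; simp [mollify, convolution]

namespace IsMollifier

variable {C ε : ℝ} {ρ f : Plane → ℝ}

theorem hasCompactSupport (h : IsMollifier C ε ρ) : HasCompactSupport ρ :=
  HasCompactSupport.of_support_subset_isCompact (isCompact_closedBall 0 ε)
    ((subset_tsupport ρ).trans h.support)

theorem contDiff_mollify (h : IsMollifier C ε ρ) (hf : LocallyIntegrable f) :
    ContDiff ℝ ∞ (mollify ρ f) := by
  rw [mollify_eq_convolution]
  exact h.hasCompactSupport.contDiff_convolution_right _ hf h.smooth

theorem fderiv_mollify (h : IsMollifier C ε ρ) (hf : LocallyIntegrable f) (x v : Plane) :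
    fderiv ℝ (mollify ρ f) x v = ∫ y, f y * fderiv ℝ ρ (x - y) v := by
  have h1 := h.hasCompactSupport.hasFDerivAt_convolution_right (ContinuousLinearMap.mul ℝ ℝ) hf
    (h.smooth.of_le (by simp)) x
  rw [mollify_eq_convolution, h1.fderiv, convolution_precompR_apply _ hf
    (h.hasCompactSupport.fderiv ℝ) (h.smooth.continuous_fderiv (by simp))]
  simp [convolution]

theorem eq_zero_of_notMem (h : IsMollifier C ε ρ) {x y : Plane} (hy : y ∉ Metric.closedBall x ε) :
    ρ (x - y) = 0 := by
  refine image_eq_zero_of_notMem_tsupport fun hm => hy ?_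
  have := h.support hm
  rwa [mem_closedBall_zero_iff, norm_sub_rev, ← mem_closedBall_iff_norm] at this

theorem fderiv_eq_zero_of_notMem (h : IsMollifier C ε ρ) {x y : Plane}
    (hy : y ∉ Metric.closedBall x ε) : fderiv ℝ ρ (x - y) = 0 := by
  have : x - y ∉ tsupport ρ := fun hm => hy (by
    have := h.support hm
    rwa [mem_closedBall_zero_iff, norm_sub_rev, ← mem_closedBall_iff_norm] at this)
  exact image_eq_zero_of_notMem_tsupport fun hm => this (tsupport_fderiv_subset ℝ hm)

theorem isTestFunction (h : IsMollifier C ε ρ) {Ω : Set Plane} {x : Plane}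
    (hx : Metric.closedBall x ε ⊆ Ω) : IsTestFunction Ω (fun y => ρ (x - y)) := by
  have hsub : Function.support (fun y => ρ (x - y)) ⊆ Metric.closedBall x ε := by
    intro y hy
    by_contra hn
    exact hy (h.eq_zero_of_notMem hn)
  refine ⟨h.smooth.comp (contDiff_const.sub contDiff_id), ?_, ?_⟩
  · exact HasCompactSupport.of_support_subset_isCompact (isCompact_closedBall x ε) hsub
  · exact (closure_minimal hsub Metric.isClosed_closedBall).trans hx

theorem fderiv_reflect (h : IsMollifier C ε ρ) (x y v : Plane) :
    fderiv ℝ (fun y => ρ (x - y)) y v = -fderiv ℝ ρ (x - y) v := by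
  have h1 : HasFDerivAt (fun y => ρ (x - y))
      ((fderiv ℝ ρ (x - y)).comp (-ContinuousLinearMap.id ℝ Plane)) y := by
    refine HasFDerivAt.comp y (h.smooth.differentiable (by simp) _).hasFDerivAt ?_
    exact (hasFDerivAt_id y).const_sub x
  rw [h1.fderiv]; simp

theorem integral_reflect (h : IsMollifier C ε ρ) (x : Plane) : ∫ y, ρ (x - y) = 1 := by
  rw [integral_sub_left_eq_self ρ volume x, h.integral_eq_one]

end IsMollifier

theorem locallyIntegrable_of_bounded {f : Plane → ℝ} (hf : Measurable f) {B : ℝ}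
    (hB : ∀ x, |f x| ≤ B) : LocallyIntegrable f := by
  refine (locallyIntegrable_const (B : ℝ)).mono hf.aestronglyMeasurable ?_
  refine Filter.Eventually.of_forall fun x => ?_
  rw [Real.norm_eq_abs, Real.norm_eq_abs]
  exact (hB x).trans (le_abs_self _)

theorem abs_integral_mul_le {g k : Plane → ℝ} {x : Plane} {ε M : ℝ}
    (hg : IntegrableOn g (Metric.closedBall x ε)) (hk : ∀ z, |k z| ≤ M)
    (hsupp : ∀ y, y ∉ Metric.closedBall x ε → k (x - y) = 0) :
    |∫ y, g y * k (x - y)| ≤ M * ∫ y in Metric.closedBall x ε, |g y| := by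
  rw [← setIntegral_eq_integral_of_forall_compl_eq_zero (s := Metric.closedBall x ε)
    (fun y hy => by rw [hsupp y hy, mul_zero]), ← integral_const_mul, ← Real.norm_eq_abs]
  refine norm_integral_le_of_norm_le (hg.abs.const_mul M) (Filter.Eventually.of_forall fun y => ?_)
  rw [norm_mul, Real.norm_eq_abs, Real.norm_eq_abs, mul_comm]
  exact mul_le_mul_of_nonneg_right (hk _) (abs_nonneg _)

namespace IsMollifier

variable {C ε : ℝ} {ρ f : Plane → ℝ}

theorem integrable_mul (h : IsMollifier C ε ρ) (hf : LocallyIntegrable f) (x : Plane) :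
    Integrable fun y => f y * ρ (x - y) := by
  have := h.hasCompactSupport.convolutionExists_right (ContinuousLinearMap.mul ℝ ℝ) hf
    h.smooth.continuous x
  simpa [ConvolutionExistsAt] using this

theorem integrable_mul_fderiv (h : IsMollifier C ε ρ) (hf : LocallyIntegrable f) (x v : Plane) :
    Integrable fun y => f y * fderiv ℝ ρ (x - y) v := by
  have hc : HasCompactSupport fun z => fderiv ℝ ρ z v := h.hasCompactSupport.fderiv_apply ℝ v
  have := hc.convolutionExists_right (ContinuousLinearMap.mul ℝ ℝ) hf
    ((h.smooth.continuous_fderiv (by simp)).clm_apply continuous_const) x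
  simpa [ConvolutionExistsAt] using this

theorem mollify_add (h : IsMollifier C ε ρ) {g : Plane → ℝ} (hf : LocallyIntegrable f)
    (hg : LocallyIntegrable g) (x : Plane) :
    mollify ρ (fun y => f y + g y) x = mollify ρ f x + mollify ρ g x := by
  unfold mollify
  rw [← integral_add (h.integrable_mul hf x) (h.integrable_mul hg x)]
  simp only [add_mul]

theorem mollify_const_mul (c : ℝ) (x : Plane) :
    mollify ρ (fun y => c * f y) x = c * mollify ρ f x := by
  unfold mollify
  rw [← integral_const_mul]
  simp only [mul_assoc]

theorem mollify_const (h : IsMollifier C ε ρ) (c : ℝ) (x : Plane) :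
    mollify ρ (fun _ => c) x = c := by
  unfold mollify
  rw [integral_const_mul, h.integral_reflect, mul_one]

theorem mollify_mono (h : IsMollifier C ε ρ) {g : Plane → ℝ} (hf : LocallyIntegrable f)
    (hg : LocallyIntegrable g) (hfg : ∀ y, f y ≤ g y) (x : Plane) :
    mollify ρ f x ≤ mollify ρ g x :=
  integral_mono (h.integrable_mul hf x) (h.integrable_mul hg x)
    fun y => mul_le_mul_of_nonneg_right (hfg y) (h.nonneg _)

theorem abs_mollify_le (h : IsMollifier C ε ρ) {x : Plane}
    (hf : IntegrableOn f (Metric.closedBall x ε)) :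
    |mollify ρ f x| ≤ C / ε ^ 2 * ∫ y in Metric.closedBall x ε, |f y| :=
  abs_integral_mul_le hf (fun z => by rw [abs_of_nonneg (h.nonneg z)]; exact h.le z)
    fun _ hy => h.eq_zero_of_notMem hy

theorem integrableOn_closedBall (hf : LocallyIntegrable f) (x : Plane) :
    IntegrableOn f (Metric.closedBall x ε) :=
  hf.integrableOn_isCompact (isCompact_closedBall x ε)

theorem mollify_sub_const (h : IsMollifier C ε ρ) (hf : LocallyIntegrable f) (c : ℝ) (x : Plane) :
    mollify ρ (fun y => f y - c) x = mollify ρ f x - c := by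
  simp only [sub_eq_add_neg]
  rw [h.mollify_add hf (locallyIntegrable_const _), h.mollify_const]

theorem abs_mollify_sub_le (h : IsMollifier C ε ρ) (hf : LocallyIntegrable f) (c : ℝ) (x : Plane) :
    |mollify ρ f x - c| ≤ C / ε ^ 2 * ∫ y in Metric.closedBall x ε, |f y - c| := by
  rw [← h.mollify_sub_const hf]
  exact h.abs_mollify_le (integrableOn_closedBall (hf.sub (locallyIntegrable_const c)) x)

/-- Mollification preserves constants, so `c` may be subtracted before differentiating; only the
oscillation of `f` counts. -/
theorem abs_fderiv_mollify_le (h : IsMollifier C ε ρ) (hf : LocallyIntegrable f) (c : ℝ)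
    (x v : Plane) : |fderiv ℝ (mollify ρ f) x v| ≤
      C / ε ^ 3 * ‖v‖ * ∫ y in Metric.closedBall x ε, |f y - c| := by
  have hfc : LocallyIntegrable fun y => f y - c := hf.sub (locallyIntegrable_const c)
  have h1 : fderiv ℝ (mollify ρ f) x v = fderiv ℝ (mollify ρ fun y => f y - c) x v := by
    have : (mollify ρ fun y => f y - c) = fun x => mollify ρ f x - c :=
      funext fun x => h.mollify_sub_const hf c x
    rw [this, fderiv_sub_const]
  rw [h1, h.fderiv_mollify hfc]
  refine abs_integral_mul_le (k := fun z => fderiv ℝ ρ z v) (integrableOn_closedBall hfc x)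
    (fun z => ?_) fun y hy => by rw [h.fderiv_eq_zero_of_notMem hy]; rfl
  exact ((fderiv ℝ ρ z).le_opNorm v).trans (mul_le_mul_of_nonneg_right (h.fderiv_le z) (norm_nonneg _))

/-- Mean square deviation equals variance plus squared bias; for a unit field the variance is the
defect `1 - |mean|²`. Both bounds on the defect below follow from this. -/
theorem mollify_sq_identity (h : IsMollifier C ε ρ) {a b : Plane → ℝ} (ha : LocallyIntegrable a)
    (hb : LocallyIntegrable b) (hab : ∀ y, a y ^ 2 + b y ^ 2 = 1) (c d : ℝ) (x : Plane) :
    mollify ρ (fun y => (a y - c) ^ 2 + (b y - d) ^ 2) x =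
      (1 - mollify ρ a x ^ 2 - mollify ρ b x ^ 2) + (mollify ρ a x - c) ^ 2
        + (mollify ρ b x - d) ^ 2 := by
  have e : (fun y => (a y - c) ^ 2 + (b y - d) ^ 2) =
      fun y => (1 + c ^ 2 + d ^ 2) + (((-2 * c) * a y) + ((-2 * d) * b y)) := by
    funext y; linear_combination hab y
  have ha' : LocallyIntegrable fun y => (-2 * c) * a y := ha.smul (-2 * c)
  have hb' : LocallyIntegrable fun y => (-2 * d) * b y := hb.smul (-2 * d)
  have hab' : LocallyIntegrable fun y => (-2 * c) * a y + (-2 * d) * b y := ha'.add hb'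
  rw [e, h.mollify_add (locallyIntegrable_const _) hab', h.mollify_add ha' hb',
    h.mollify_const, mollify_const_mul, mollify_const_mul]
  ring

theorem defect_nonneg (h : IsMollifier C ε ρ) {a b : Plane → ℝ} (ha : LocallyIntegrable a)
    (hb : LocallyIntegrable b) (hab : ∀ y, a y ^ 2 + b y ^ 2 = 1) (x : Plane) :
    0 ≤ 1 - mollify ρ a x ^ 2 - mollify ρ b x ^ 2 := by
  have h1 := h.mollify_sq_identity ha hb hab (mollify ρ a x) (mollify ρ b x) x
  have h2 : 0 ≤ mollify ρ (fun y => (a y - mollify ρ a x) ^ 2 + (b y - mollify ρ b x) ^ 2) x :=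
    integral_nonneg fun y => mul_nonneg (by positivity) (h.nonneg _)
  linarith

theorem defect_le (h : IsMollifier C ε ρ) {a b : Plane → ℝ} (ha : LocallyIntegrable a)
    (hb : LocallyIntegrable b) (hab : ∀ y, a y ^ 2 + b y ^ 2 = 1) (c d : ℝ) (x : Plane) :
    1 - mollify ρ a x ^ 2 - mollify ρ b x ^ 2 ≤
      C / ε ^ 2 * ∫ y in Metric.closedBall x ε, ((a y - c) ^ 2 + (b y - d) ^ 2) := by
  have h1 := h.mollify_sq_identity ha hb hab c d x
  have e : (fun y => (a y - c) ^ 2 + (b y - d) ^ 2) =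
      fun y => (1 + c ^ 2 + d ^ 2) + (((-2 * c) * a y) + ((-2 * d) * b y)) := by
    funext y; linear_combination hab y
  have hl : LocallyIntegrable fun y => (a y - c) ^ 2 + (b y - d) ^ 2 := by
    rw [e]
    exact (locallyIntegrable_const _).add ((ha.smul (-2 * c)).add (hb.smul (-2 * d)))
  have h2 := (le_abs_self _).trans (h.abs_mollify_le (integrableOn_closedBall hl x))
  have h3 : ∀ y, |(a y - c) ^ 2 + (b y - d) ^ 2| = (a y - c) ^ 2 + (b y - d) ^ 2 :=
    fun y => abs_of_nonneg (by positivity)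
  simp only [h3] at h2
  nlinarith [sq_nonneg (mollify ρ a x - c), sq_nonneg (mollify ρ b x - d)]

end IsMollifier

/-- A cubic rearrangement inequality on finite measure spaces. -/
theorem integral_sq_mul_integral_le {α : Type*} [MeasurableSpace α] (μ : Measure α)
    [IsFiniteMeasure μ] {F : α → ℝ} (hF : Measurable F) {B : ℝ} (h0 : ∀ y, 0 ≤ F y)
    (hB : ∀ y, F y ≤ B) :
    (∫ y, F y ^ 2 ∂μ) * ∫ y, F y ∂μ ≤ 2 * μ.real Set.univ * ∫ y, F y ^ 3 ∂μ := by
  have hintegrable : ∀ k : ℕ, Integrable (fun y => F y ^ k) μ := fun k =>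
    Integrable.of_bound (hF.pow_const k).aestronglyMeasurable (B ^ k)
      (Filter.Eventually.of_forall fun y => by
        rw [Real.norm_of_nonneg (pow_nonneg (h0 y) k)]
        exact pow_le_pow_left₀ (h0 y) (hB y) k)
  -- This elementary inequality, with `s` and `t` taken as values of `F` at two independent points,
  -- is integrated in each of them.
  have hcub : ∀ s t : ℝ, 0 ≤ s → 0 ≤ t → s ^ 2 * t ≤ s ^ 3 + t ^ 3 := by
    intro s t hs ht
    rcases le_total s t with hst | hst
    · have : s ^ 2 * t ≤ t ^ 2 * t := by gcongr
      have : 0 ≤ s ^ 3 := by positivity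
      linarith
    · have : s ^ 2 * t ≤ s ^ 2 * s := by gcongr
      have : 0 ≤ t ^ 3 := by positivity
      linarith
  have h1 : ∀ t : ℝ, 0 ≤ t → (∫ y, F y ^ 2 ∂μ) * t ≤ (∫ y, F y ^ 3 ∂μ) + μ.real Set.univ * t ^ 3 := by
    intro t ht
    have := integral_mono ((hintegrable 2).mul_const t) ((hintegrable 3).add (integrable_const (t ^ 3)))
      fun y => hcub (F y) t (h0 y) ht
    simp only [Pi.add_apply] at this
    rw [integral_add (hintegrable 3) (integrable_const _), integral_mul_const, integral_const,
      smul_eq_mul] at this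
    exact this
  have hF1 : Integrable F μ := by simpa using hintegrable 1
  have h2 := integral_mono (hF1.const_mul (∫ y, F y ^ 2 ∂μ))
    ((integrable_const (∫ y, F y ^ 3 ∂μ)).add ((hintegrable 3).const_mul (μ.real Set.univ)))
    fun y => h1 (F y) (h0 y)
  simp only [Pi.add_apply] at h2
  rw [integral_add (integrable_const _) ((hintegrable 3).const_mul _), integral_const_mul,
    integral_const_mul, integral_const, smul_eq_mul] at h2
  linarith

/-! ### Defect times gradient: the cubic estimate -/

/-- The component of the field `u` in the direction `ξ`. -/
noncomputable def component (ξ : Plane) (u : Plane → Plane) (y : Plane) : ℝ := ⟪ξ, u y⟫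

/-- The defect `1 - |u_ρ|²` of the mollified field, in the frame `ξ, ξ^⊥`. -/
noncomputable def defect (ρ : Plane → ℝ) (ξ : Plane) (u : Plane → Plane) (x : Plane) : ℝ :=
  1 - mollify ρ (component ξ u) x ^ 2 - mollify ρ (component (perp ξ) u) x ^ 2

theorem frame_norm_sq {ξ : Plane} (hξ : ‖ξ‖ = 1) (e : Plane) :
    ⟪ξ, e⟫ ^ 2 + ⟪perp ξ, e⟫ ^ 2 = ‖e‖ ^ 2 := by
  have h := plane_norm_sq ξ
  rw [hξ] at h
  rw [plane_norm_sq, plane_inner, plane_inner]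
  simp
  linear_combination (-(e 0 ^ 2 + e 1 ^ 2)) * h

theorem frame_expansion {ξ : Plane} (hξ : ‖ξ‖ = 1) (e : Plane) :
    ⟪ξ, e⟫ • ξ + ⟪perp ξ, e⟫ • perp ξ = e := by
  have h := plane_norm_sq ξ
  rw [hξ] at h
  rw [plane_inner, plane_inner]
  apply plane_ext
  · simp; linear_combination (-e 0) * h
  · simp; linear_combination (-e 1) * h

section

variable {u : Plane → Plane} {ξ : Plane}

theorem measurable_component (hu : Measurable u) (ξ : Plane) : Measurable (component ξ u) :=
  (measurable_const.inner hu : Measurable fun y => ⟪ξ, u y⟫)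

theorem abs_component_le (hu1 : ∀ x, ‖u x‖ = 1) (ξ y : Plane) : |component ξ u y| ≤ ‖ξ‖ := by
  simpa [component, hu1 y] using abs_real_inner_le_norm ξ (u y)

theorem locallyIntegrable_component (hu : Measurable u) (hu1 : ∀ x, ‖u x‖ = 1) (ξ : Plane) :
    LocallyIntegrable (component ξ u) :=
  locallyIntegrable_of_bounded (measurable_component hu ξ) (abs_component_le hu1 ξ)

theorem component_sq_add_sq (hu1 : ∀ x, ‖u x‖ = 1) (hξ : ‖ξ‖ = 1) (y : Plane) :
    component ξ u y ^ 2 + component (perp ξ) u y ^ 2 = 1 := by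
  rw [component, component, frame_norm_sq hξ, hu1, one_pow]

theorem norm_sub_le_two (hu1 : ∀ x, ‖u x‖ = 1) (x y : Plane) : ‖u y - u x‖ ≤ 2 := by
  have := norm_sub_le (u y) (u x)
  rw [hu1, hu1] at this
  linarith

theorem integrableOn_norm_sub_pow (hu : Measurable u) (hu1 : ∀ x, ‖u x‖ = 1) (x : Plane) (ε : ℝ)
    (k : ℕ) : IntegrableOn (fun y => ‖u y - u x‖ ^ k) (Metric.closedBall x ε) := by
  refine IsMollifier.integrableOn_closedBall (locallyIntegrable_of_bounded (B := 2 ^ k) ?_ ?_) x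
  · exact ((hu.sub_const _).norm).pow_const k
  · intro y
    rw [abs_of_nonneg (by positivity)]
    exact pow_le_pow_left₀ (norm_nonneg _) (norm_sub_le_two hu1 x y) k

variable {C ε : ℝ} {ρ : Plane → ℝ}

theorem IsMollifier.defect_component_nonneg (h : IsMollifier C ε ρ) (hu : Measurable u)
    (hu1 : ∀ x, ‖u x‖ = 1) (hξ : ‖ξ‖ = 1) (x : Plane) : 0 ≤ defect ρ ξ u x :=
  h.defect_nonneg (locallyIntegrable_component hu hu1 ξ) (locallyIntegrable_component hu hu1 _)
    (component_sq_add_sq hu1 hξ) x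

theorem defect_le_one (x : Plane) : defect ρ ξ u x ≤ 1 := by
  unfold defect
  nlinarith [sq_nonneg (mollify ρ (component ξ u) x), sq_nonneg (mollify ρ (component (perp ξ) u) x)]

theorem IsMollifier.defect_component_le (h : IsMollifier C ε ρ) (hu : Measurable u)
    (hu1 : ∀ x, ‖u x‖ = 1) (hξ : ‖ξ‖ = 1) (x : Plane) :
    defect ρ ξ u x ≤ C / ε ^ 2 * ∫ y in Metric.closedBall x ε, ‖u y - u x‖ ^ 2 := by
  have := h.defect_le (locallyIntegrable_component hu hu1 ξ) (locallyIntegrable_component hu hu1 _)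
    (component_sq_add_sq hu1 hξ) (component ξ u x) (component (perp ξ) u x) x
  simpa only [defect, component, ← inner_sub_right, frame_norm_sq hξ] using this

theorem IsMollifier.abs_fderiv_component_le (h : IsMollifier C ε ρ) (hC : 0 ≤ C) (hε : 0 < ε)
    (hu : Measurable u) (hu1 : ∀ x, ‖u x‖ = 1) (hξ : ‖ξ‖ = 1) (x v : Plane) :
    |fderiv ℝ (mollify ρ (component ξ u)) x v| ≤
      C / ε ^ 3 * ‖v‖ * ∫ y in Metric.closedBall x ε, ‖u y - u x‖ := by
  refine (h.abs_fderiv_mollify_le (locallyIntegrable_component hu hu1 ξ) (component ξ u x) x v).trans ?_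
  refine mul_le_mul_of_nonneg_left (setIntegral_mono_on ?_ ?_ measurableSet_closedBall
    fun y _ => ?_) (by positivity)
  · exact (IsMollifier.integrableOn_closedBall ((locallyIntegrable_component hu hu1 ξ).sub
      (locallyIntegrable_const _)) x).abs
  · simpa using integrableOn_norm_sub_pow hu hu1 x ε 1
  · simp only [component, ← inner_sub_right]
    simpa [hξ] using abs_real_inner_le_norm ξ (u y - u x)

theorem volume_real_closedBall (x : Plane) {ε : ℝ} (hε : 0 ≤ ε) :
    volume.real (Metric.closedBall x ε) = Real.pi * ε ^ 2 := by
  rw [Measure.real, EuclideanSpace.volume_closedBall_fin_two, ENNReal.toReal_mul,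
    ENNReal.toReal_pow, ENNReal.toReal_ofReal hε, ENNReal.toReal_ofReal Real.pi_pos.le, mul_comm]

/-- The defect is controlled by second moments of `u y - u x`, the gradient by first moments. Their
product is controlled by third moments, which is why the order 1/3 at exponent 3 is the critical
regularity for this argument. -/
theorem IsMollifier.defect_mul_abs_fderiv_le (h : IsMollifier C ε ρ) (hC : 0 ≤ C) (hε : 0 < ε)
    (hu : Measurable u) (hu1 : ∀ x, ‖u x‖ = 1) (hξ : ‖ξ‖ = 1) (x v : Plane) :
    defect ρ ξ u x * |fderiv ℝ (mollify ρ (component ξ u)) x v| ≤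
      2 * Real.pi * C ^ 2 * ‖v‖ * ∫ y in Metric.closedBall x ε, ‖u y - u x‖ ^ 3 / ε ^ 3 := by
  have h1 := h.defect_component_le hu hu1 hξ x
  have h2 := h.abs_fderiv_component_le hC hε hu hu1 hξ x v
  have : IsFiniteMeasure (volume.restrict (Metric.closedBall x ε)) :=
    ⟨by rw [Measure.restrict_apply_univ]; exact measure_closedBall_lt_top⟩
  have h3 := integral_sq_mul_integral_le (volume.restrict (Metric.closedBall x ε))
    (F := fun y => ‖u y - u x‖) (hu.sub_const _).norm (B := 2) (fun y => norm_nonneg _)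
    (norm_sub_le_two hu1 x)
  have hV : (volume.restrict (Metric.closedBall x ε)).real Set.univ = Real.pi * ε ^ 2 := by
    rw [measureReal_restrict_apply_univ, volume_real_closedBall x hε.le]
  rw [hV] at h3
  rw [integral_div]
  set I1 := ∫ y in Metric.closedBall x ε, ‖u y - u x‖
  set I2 := ∫ y in Metric.closedBall x ε, ‖u y - u x‖ ^ 2
  set I3 := ∫ y in Metric.closedBall x ε, ‖u y - u x‖ ^ 3
  have hI2 : 0 ≤ C / ε ^ 2 * I2 := (h.defect_component_nonneg hu hu1 hξ x).trans h1
  calc defect ρ ξ u x * |fderiv ℝ (mollify ρ (component ξ u)) x v|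
      ≤ (C / ε ^ 2 * I2) * (C / ε ^ 3 * ‖v‖ * I1) :=
        mul_le_mul h1 h2 (abs_nonneg _) hI2
    _ = C ^ 2 * ‖v‖ / ε ^ 5 * (I2 * I1) := by field_simp
    _ ≤ C ^ 2 * ‖v‖ / ε ^ 5 * (2 * (Real.pi * ε ^ 2) * I3) := by gcongr
    _ = 2 * Real.pi * C ^ 2 * ‖v‖ * (I3 / ε ^ 3) := by field_simp

/-- Increments of a unit field are at most 2, so control of p-th powers with `p ≤ 3` yields control
of cubes; 8 bounds `2 ^ (3 - p)`. -/
theorem cube_le_rpow {p t : ℝ} (hp : 1 ≤ p) (hp3 : p ≤ 3) (h0 : 0 ≤ t) (h2 : t ≤ 2) :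
    t ^ 3 ≤ 8 * t ^ p := by
  have e : t ^ 3 = t ^ p * t ^ (3 - p) := by
    rw [← Real.rpow_add_of_nonneg h0 (by linarith) (by linarith), add_sub_cancel]
    exact_mod_cast (Real.rpow_natCast t 3).symm
  have h3 : t ^ (3 - p) ≤ 8 :=
    calc t ^ (3 - p) ≤ 2 ^ (3 - p) := Real.rpow_le_rpow h0 h2 (by linarith)
      _ ≤ (2 : ℝ) ^ (3 : ℝ) := Real.rpow_le_rpow_of_exponent_le (by norm_num) (by linarith)
      _ = 8 := by norm_num
  rw [e, mul_comm 8]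
  exact mul_le_mul_of_nonneg_left h3 (Real.rpow_nonneg h0 p)

/-- The Gagliardo kernel. -/
noncomputable def gagliardoKernel (p : ℝ) (u : Plane → Plane) (z : Plane × Plane) : ENNReal :=
  ENNReal.ofReal (‖u z.1 - u z.2‖ ^ p / ‖z.1 - z.2‖ ^ (3 : ℝ))

theorem measurable_gagliardoKernel (p : ℝ) (hu : Measurable u) :
    Measurable (gagliardoKernel p u) := by
  unfold gagliardoKernel
  refine ENNReal.measurable_ofReal.comp (Measurable.div ?_ ?_)
  · exact (((hu.comp measurable_fst).sub (hu.comp measurable_snd)).norm).pow_const p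
  · exact ((measurable_fst.sub measurable_snd).norm).pow_const _

/-- On the ball `‖x - y‖ ≤ ε`, so the weight `1 / ε ^ 3` is at most the singular weight of the
kernel. -/
theorem IsMollifier.ofReal_defect_mul_le {p : ℝ} (hp : 1 ≤ p) (hp3 : p ≤ 3)
    (h : IsMollifier C ε ρ) (hC : 0 ≤ C) (hε : 0 < ε)
    (hu : Measurable u) (hu1 : ∀ x, ‖u x‖ = 1) (hξ : ‖ξ‖ = 1) (x v : Plane) :
    ENNReal.ofReal (defect ρ ξ u x * |fderiv ℝ (mollify ρ (component ξ u)) x v|) ≤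
      ENNReal.ofReal (16 * Real.pi * C ^ 2 * ‖v‖) *
        ∫⁻ y in Metric.closedBall x ε, gagliardoKernel p u (x, y) := by
  refine (ENNReal.ofReal_le_ofReal (h.defect_mul_abs_fderiv_le hC hε hu hu1 hξ x v)).trans ?_
  rw [show 16 * Real.pi * C ^ 2 * ‖v‖ = 2 * Real.pi * C ^ 2 * ‖v‖ * 8 by ring,
    ENNReal.ofReal_mul (q := 8) (by positivity),
    ENNReal.ofReal_mul (p := 2 * Real.pi * C ^ 2 * ‖v‖) (by positivity),
    mul_assoc (ENNReal.ofReal _)]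
  refine mul_le_mul_right ?_ _
  rw [ofReal_integral_eq_lintegral_ofReal ((integrableOn_norm_sub_pow hu hu1 x ε 3).div_const _)
    (Filter.Eventually.of_forall fun y => by positivity),
    ← lintegral_const_mul (f := fun y => gagliardoKernel p u (x, y)) _
      ((measurable_gagliardoKernel p hu).comp measurable_prodMk_left)]
  refine setLIntegral_mono' measurableSet_closedBall fun y hy => ?_
  rw [gagliardoKernel, ← ENNReal.ofReal_mul (by norm_num)]
  refine ENNReal.ofReal_le_ofReal ?_
  rcases eq_or_ne x y with rfl | hxy
  · simp only [sub_self, norm_zero]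
    rw [Real.zero_rpow (by linarith)]; simp
  have hpos : 0 < ‖x - y‖ := norm_pos_iff.2 (sub_ne_zero.2 hxy)
  have hle : ‖x - y‖ ≤ ε := by rwa [Metric.mem_closedBall, dist_comm, dist_eq_norm] at hy
  rw [norm_sub_rev (u y), ← mul_div_assoc]
  have e : ‖x - y‖ ^ (3 : ℝ) = ‖x - y‖ ^ 3 := by exact_mod_cast Real.rpow_natCast ‖x - y‖ 3
  rw [e]
  have := cube_le_rpow hp hp3 (norm_nonneg (u x - u y)) (norm_sub_le_two hu1 y x)
  gcongr

end

/-! ### Vanishing of defect times gradient -/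

/-- The products of defect and gradient of mollifications of `u` vanish in `L¹_loc(Ω)`. -/
def CommutatorVanishes (Ω : Set Plane) (u : Plane → Plane) : Prop :=
  ∀ (C : ℝ) (ε : ℕ → ℝ) (ρ : ℕ → Plane → ℝ), 0 ≤ C → (∀ n, 0 < ε n) →
    Filter.Tendsto ε Filter.atTop (𝓝 0) → (∀ n, IsMollifier C (ε n) (ρ n)) →
    ∀ ξ : Plane, ‖ξ‖ = 1 → ∀ v : Plane, ∀ K ⊆ Ω, IsCompact K →
    Filter.Tendsto (fun n => ∫⁻ x in K, ENNReal.ofReal (defect (ρ n) ξ u x *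
      |fderiv ℝ (mollify (ρ n) (component ξ u)) x v|)) Filter.atTop (𝓝 0)

/-- The bound is the integral of an integrable kernel over the strip `|x - y| ≤ ε n`. The strips
shrink to the diagonal, where the kernel is zero, and dominated convergence applies. -/
theorem commutatorVanishes_of_gagliardo {Ω : Set Plane} (hΩ : IsOpen Ω) {p : ℝ} (hp : 1 ≤ p)
    (hp3 : p ≤ 3) {u : Plane → Plane} (hu : Measurable u) (hu1 : ∀ x, ‖u x‖ = 1)
    (hG : ∀ K : Set Plane, IsCompact K → K ⊆ Ω →
      ∫⁻ x in K, ∫⁻ y in K, gagliardoKernel p u (x, y) < ⊤) : CommutatorVanishes Ω u := by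
  intro C ε ρ hC hε hε0 hρ ξ hξ v K hKΩ hK
  obtain ⟨δ, hδ, hδΩ⟩ := hK.exists_cthickening_subset_open hΩ hKΩ
  set K' := Metric.cthickening δ K with hK'
  have hK'c : IsCompact K' := hK.cthickening
  have hKK' : K ⊆ K' := Metric.self_subset_cthickening K
  set g := gagliardoKernel p u with hg
  have hgm : Measurable g := measurable_gagliardoKernel p hu
  set near : ℕ → Set (Plane × Plane) := fun n => {z | dist z.2 z.1 ≤ ε n} with hnear
  have hnm : ∀ n, MeasurableSet (near n) := fun n =>
    measurableSet_le (measurable_snd.dist measurable_fst) measurable_const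
  set μ := (volume.restrict K).prod (volume.restrict K') with hμ
  have hfin : ∫⁻ z, g z ∂μ ≠ ⊤ := by
    rw [hμ, lintegral_prod _ hgm.aemeasurable]
    refine ((lintegral_mono_set hKK').trans_lt (hG K' hK'c hδΩ)).ne
  have hlim : Filter.Tendsto (fun n => ∫⁻ z, (near n).indicator g z ∂μ) Filter.atTop (𝓝 0) := by
    have := tendsto_lintegral_of_dominated_convergence (μ := μ) (F := fun n => (near n).indicator g)
      (f := fun _ => 0) g (fun n => hgm.indicator (hnm n))
      (fun n => Filter.Eventually.of_forall fun z => Set.indicator_le_self _ _ z) hfin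
      (Filter.Eventually.of_forall fun z => ?_)
    · simpa using this
    · rcases eq_or_ne z.1 z.2 with hz | hz
      · have : g z = 0 := by
          rw [hg, gagliardoKernel, hz]
          simp [Real.zero_rpow (by linarith : p ≠ 0)]
        refine tendsto_const_nhds.congr fun n => ?_
        simp [Set.indicator, this]
      · have hd : 0 < dist z.2 z.1 := dist_pos.2 (Ne.symm hz)
        refine tendsto_const_nhds.congr' ?_
        filter_upwards [hε0.eventually (gt_mem_nhds hd)] with n hn
        rw [Set.indicator_of_notMem]
        simp only [hnear, Set.mem_ofPred_eq, not_le]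
        exact hn
  have hlim' := ENNReal.Tendsto.const_mul (a := ENNReal.ofReal (16 * Real.pi * C ^ 2 * ‖v‖)) hlim
    (Or.inr ENNReal.ofReal_ne_top)
  rw [mul_zero] at hlim'
  refine tendsto_of_tendsto_of_tendsto_of_le_of_le' tendsto_const_nhds hlim'
    (Filter.Eventually.of_forall fun _ => zero_le) ?_
  filter_upwards [hε0.eventually (gt_mem_nhds hδ)] with n hn
  rw [hμ, lintegral_prod _ (hgm.indicator (hnm n)).aemeasurable,
    ← lintegral_const_mul _ (hgm.indicator (hnm n)).lintegral_prod_right']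
  refine setLIntegral_mono' hK.measurableSet fun x hx => ?_
  refine ((hρ n).ofReal_defect_mul_le hp hp3 hC (hε n) hu hu1 hξ x v).trans ?_
  refine mul_le_mul_right ?_ _
  have hsub : Metric.closedBall x (ε n) ⊆ K' :=
    (Metric.closedBall_subset_closedBall hn.le).trans
      (Metric.closedBall_subset_cthickening hx δ)
  rw [← lintegral_indicator measurableSet_closedBall, ← lintegral_indicator hK'c.measurableSet]
  refine lintegral_mono fun y => ?_
  by_cases hy : y ∈ Metric.closedBall x (ε n)
  · have : (x, y) ∈ near n := hy
    rw [Set.indicator_of_mem hy, Set.indicator_of_mem (hsub hy), Set.indicator_of_mem this]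
  · rw [Set.indicator_of_notMem hy]; exact zero_le

/-- Lebesgue points, for balls that need not be centred. -/
def IsLebesguePoint (u : Plane → Plane) (x : Plane) : Prop :=
  ∀ (w : ℕ → Plane) (δ : ℕ → ℝ), Filter.Tendsto δ Filter.atTop (𝓝[>] 0) →
    (∀ᶠ j in Filter.atTop, x ∈ Metric.closedBall (w j) (2 * δ j)) →
    Filter.Tendsto (fun j => ⨍ y in Metric.closedBall (w j) (δ j), ‖u y - u x‖) Filter.atTop (𝓝 0)

section

variable {u : Plane → Plane} {ξ : Plane}

theorem ae_isLebesguePoint (hu : LocallyIntegrable u) : ∀ᵐ x, IsLebesguePoint u x := by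
  filter_upwards [IsUnifLocDoublingMeasure.ae_tendsto_average_norm_sub volume hu 2] with x hx
  intro w δ hδ hw
  exact hx w δ hδ hw

theorem locallyIntegrable_of_norm_eq_one (hu : Measurable u) (hu1 : ∀ x, ‖u x‖ = 1) :
    LocallyIntegrable u :=
  (locallyIntegrable_const (1 : ℝ)).mono hu.aestronglyMeasurable
    (Filter.Eventually.of_forall fun x => by simp [hu1 x])

theorem IsLebesguePoint.tendsto {x : Plane} (hx : IsLebesguePoint u x) {ε : ℕ → ℝ}
    (hε : ∀ n, 0 < ε n) (hε0 : Filter.Tendsto ε Filter.atTop (𝓝 0)) (C : ℝ) :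
    Filter.Tendsto (fun n => C / ε n ^ 2 * ∫ y in Metric.closedBall x (ε n), ‖u y - u x‖)
      Filter.atTop (𝓝 0) := by
  have h := hx (fun _ => x) ε (tendsto_nhdsWithin_iff.2 ⟨hε0, Filter.Eventually.of_forall hε⟩)
    (Filter.Eventually.of_forall fun n => Metric.mem_closedBall_self (by linarith [hε n]))
  have h2 := h.const_mul (C * Real.pi)
  rw [mul_zero] at h2
  refine h2.congr fun n => ?_
  rw [setAverage_eq, volume_real_closedBall x (hε n).le, smul_eq_mul]
  have := hε n
  field_simp

theorem tendsto_mollify_component (hu : Measurable u) (hu1 : ∀ x, ‖u x‖ = 1) {x : Plane}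
    (hx : IsLebesguePoint u x) {C : ℝ} {ε : ℕ → ℝ} {ρ : ℕ → Plane → ℝ} (hC : 0 ≤ C)
    (hε : ∀ n, 0 < ε n) (hε0 : Filter.Tendsto ε Filter.atTop (𝓝 0))
    (hρ : ∀ n, IsMollifier C (ε n) (ρ n)) (ξ : Plane) :
    Filter.Tendsto (fun n => mollify (ρ n) (component ξ u) x) Filter.atTop
      (𝓝 (component ξ u x)) := by
  rw [tendsto_iff_dist_tendsto_zero]
  refine squeeze_zero (fun _ => dist_nonneg) (fun n => ?_) (hx.tendsto hε hε0 (C * ‖ξ‖))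
  rw [Real.dist_eq]
  refine ((hρ n).abs_mollify_sub_le (locallyIntegrable_component hu hu1 ξ) _ x).trans ?_
  rw [mul_div_right_comm, mul_assoc]
  have := hε n
  refine mul_le_mul_of_nonneg_left ?_ (by positivity)
  rw [← integral_const_mul]
  refine setIntegral_mono_on ?_ ?_ measurableSet_closedBall fun y _ => ?_
  · exact (IsMollifier.integrableOn_closedBall ((locallyIntegrable_component hu hu1 ξ).sub
      (locallyIntegrable_const _)) x).abs
  · have := integrableOn_norm_sub_pow hu hu1 x (ε n) 1
    simp only [pow_one] at this
    exact this.const_mul _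
  · simp only [component, ← inner_sub_right]
    exact abs_real_inner_le_norm ξ (u y - u x)

theorem tendsto_defect (hu : Measurable u) (hu1 : ∀ x, ‖u x‖ = 1) (hξ : ‖ξ‖ = 1) {x : Plane}
    (hx : IsLebesguePoint u x) {C : ℝ} {ε : ℕ → ℝ} {ρ : ℕ → Plane → ℝ} (hC : 0 ≤ C)
    (hε : ∀ n, 0 < ε n) (hε0 : Filter.Tendsto ε Filter.atTop (𝓝 0))
    (hρ : ∀ n, IsMollifier C (ε n) (ρ n)) :
    Filter.Tendsto (fun n => defect (ρ n) ξ u x) Filter.atTop (𝓝 0) := by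
  have h1 := tendsto_mollify_component hu hu1 hx hC hε hε0 hρ ξ
  have h2 := tendsto_mollify_component hu hu1 hx hC hε hε0 hρ (perp ξ)
  have h3 := (tendsto_const_nhds (x := (1 : ℝ))).sub (h1.pow 2) |>.sub (h2.pow 2)
  have h4 : 1 - component ξ u x ^ 2 - component (perp ξ) u x ^ 2 = 0 := by
    linarith [component_sq_add_sq hu1 hξ x]
  rw [h4] at h3
  exact h3

theorem continuous_defect {C ε : ℝ} {ρ : Plane → ℝ} (h : IsMollifier C ε ρ) (hu : Measurable u)
    (hu1 : ∀ x, ‖u x‖ = 1) (ξ : Plane) : Continuous (defect ρ ξ u) := by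
  have h1 := (h.contDiff_mollify (locallyIntegrable_component hu hu1 ξ)).continuous
  have h2 := (h.contDiff_mollify (locallyIntegrable_component hu hu1 (perp ξ))).continuous
  exact (continuous_const.sub (h1.pow 2)).sub (h2.pow 2)

theorem tendsto_lintegral_defect (hu : Measurable u) (hu1 : ∀ x, ‖u x‖ = 1) (hξ : ‖ξ‖ = 1)
    {C : ℝ} {ε : ℕ → ℝ} {ρ : ℕ → Plane → ℝ} (hC : 0 ≤ C)
    (hε : ∀ n, 0 < ε n) (hε0 : Filter.Tendsto ε Filter.atTop (𝓝 0))
    (hρ : ∀ n, IsMollifier C (ε n) (ρ n)) {K : Set Plane} (hK : IsCompact K) :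
    Filter.Tendsto (fun n => ∫⁻ x in K, ENNReal.ofReal (defect (ρ n) ξ u x)) Filter.atTop
      (𝓝 0) := by
  have := tendsto_lintegral_of_dominated_convergence (μ := volume.restrict K)
    (F := fun n x => ENNReal.ofReal (defect (ρ n) ξ u x)) (f := fun _ => 0) (fun _ => 1)
    (fun n => ENNReal.measurable_ofReal.comp (continuous_defect (hρ n) hu hu1 ξ).measurable)
    (fun n => Filter.Eventually.of_forall fun x => by
      simpa using ENNReal.ofReal_le_ofReal (defect_le_one (ρ := ρ n) (ξ := ξ) (u := u) x))
    (by simpa using hK.measure_lt_top.ne) ?_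
  · simpa using this
  · filter_upwards [ae_restrict_of_ae (ae_isLebesguePoint
      (locallyIntegrable_of_norm_eq_one hu hu1))] with x hx
    have := ENNReal.tendsto_ofReal (tendsto_defect hu hu1 hξ hx hC hε hε0 hρ)
    simpa using this

theorem IsMollifier.lintegral_mollify {C ε : ℝ} {ρ : Plane → ℝ} (h : IsMollifier C ε ρ)
    {g : Plane → ℝ} (hg : Integrable g) (hg0 : ∀ y, 0 ≤ g y) :
    ∫⁻ x, ENNReal.ofReal (mollify ρ g x) = ENNReal.ofReal (∫ y, g y) := by
  have hρi : Integrable ρ := h.smooth.continuous.integrable_of_hasCompactSupport h.hasCompactSupport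
  have h1 := hg.integrable_convolution (ContinuousLinearMap.mul ℝ ℝ) hρi
  rw [← mollify_eq_convolution] at h1
  rw [← ofReal_integral_eq_lintegral_ofReal h1 (Filter.Eventually.of_forall fun x =>
    integral_nonneg fun y => mul_nonneg (hg0 y) (h.nonneg _)), mollify_eq_convolution,
    integral_convolution _ hg hρi]
  simp [h.integral_eq_one]

/-- The mollified weak derivative is the derivative of the mollification. -/
theorem IsMollifier.fderiv_mollify_of_isWeakDeriv {Ω K : Set Plane} {C ε : ℝ} {ρ : Plane → ℝ}
    (h : IsMollifier C ε ρ) (hu : Measurable u) (hu1 : ∀ x, ‖u x‖ = 1)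
    {G : Plane → Plane →L[ℝ] Plane} (hG : IsWeakDeriv Ω u G) (hK : IsCompact K) (hKΩ : K ⊆ Ω)
    (hGK : IntegrableOn G K) (ξ v : Plane) {x : Plane} (hx : Metric.closedBall x ε ⊆ K) :
    fderiv ℝ (mollify ρ (component ξ u)) x v =
      mollify ρ (K.indicator fun y => ⟪ξ, G y v⟫) x := by
  have hw := hG _ (h.isTestFunction (hx.trans hKΩ)) v
  simp only [h.fderiv_reflect] at hw
  rw [setIntegral_eq_integral_of_forall_compl_eq_zero (fun y hy => by
      rw [h.fderiv_eq_zero_of_notMem fun hm => hy (hKΩ (hx hm))]; simp),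
    setIntegral_eq_integral_of_forall_compl_eq_zero (fun y hy => by
      rw [h.eq_zero_of_notMem fun hm => hy (hKΩ (hx hm))]; simp),
    ← setIntegral_eq_integral_of_forall_compl_eq_zero (s := K) (f := fun y => ρ (x - y) • G y v)
      (fun y hy => by rw [h.eq_zero_of_notMem fun hm => hy (hx hm)]; simp)] at hw
  have hw' := congrArg (fun e => ⟪ξ, e⟫) hw
  simp only [inner_neg_right] at hw'
  have i1 : Integrable fun y => -(fderiv ℝ ρ (x - y)) v • u y := by
    have hk : Integrable fun y => -(fderiv ℝ ρ (x - y)) v := by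
      have := (h.integrable_mul_fderiv (f := fun _ => (1 : ℝ)) (locallyIntegrable_const _) x v).neg
      simpa using this
    exact hk.smul_of_top_left (memLp_top_of_bound hu.aestronglyMeasurable 1
      (Filter.Eventually.of_forall fun y => by simp [hu1 y]))
  have i2 : IntegrableOn (fun y => ρ (x - y) • G y v) K := by
    have hGv : IntegrableOn (fun y => G y v) K := hGK.apply_continuousLinearMap v
    refine hGv.continuousOn_smul ?_ hK
    exact (h.smooth.continuous.comp (continuous_const.sub continuous_id)).continuousOn
  rw [← integral_inner i1, ← integral_inner i2] at hw'
  rw [h.fderiv_mollify (locallyIntegrable_component hu hu1 ξ)]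
  unfold mollify
  simp only [inner_smul_right, neg_mul, integral_neg, neg_inj] at hw'
  calc ∫ y, component ξ u y * fderiv ℝ ρ (x - y) v = ∫ y, fderiv ℝ ρ (x - y) v * ⟪ξ, u y⟫ := by
        simp only [component, mul_comm]
    _ = ∫ y in K, ρ (x - y) * ⟪ξ, G y v⟫ := hw'
    _ = ∫ y, K.indicator (fun y => ⟪ξ, G y v⟫) y * ρ (x - y) := by
        rw [← integral_indicator hK.measurableSet]
        congr 1
        funext y
        by_cases hy : y ∈ K
        · simp [hy, mul_comm]
        · simp [hy]

/-- The weak gradient is split into a bounded part `k` and a remainder small in L¹. The first meets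
a defect tending to 0 in L¹, the second a defect bounded by 1. -/
theorem commutatorVanishes_of_isWeakDeriv {Ω : Set Plane} (hΩ : IsOpen Ω)
    (hu : Measurable u) (hu1 : ∀ x, ‖u x‖ = 1) {G : Plane → Plane →L[ℝ] Plane}
    (hG : IsWeakDeriv Ω u G)
    (hGK : ∀ K : Set Plane, IsCompact K → K ⊆ Ω → IntegrableOn G K) : CommutatorVanishes Ω u := by
  intro C ε ρ hC hε hε0 hρ ξ hξ v K hKΩ hK
  obtain ⟨δ, hδ, hδΩ⟩ := hK.exists_cthickening_subset_open hΩ hKΩ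
  set K' := Metric.cthickening δ K with hK'
  have hK'c : IsCompact K' := hK.cthickening
  set g : Plane → ℝ := K'.indicator fun y => ⟪ξ, G y v⟫ with hg
  have hgi : Integrable g := by
    rw [hg, integrable_indicator_iff hK'c.measurableSet]
    exact ((hGK K' hK'c hδΩ).apply_continuousLinearMap v).const_inner ξ
  rw [ENNReal.tendsto_nhds_zero]
  intro η hη
  obtain ⟨η', hη'0, hη'⟩ : ∃ η' : ℝ, 0 < η' ∧ ENNReal.ofReal η' + ENNReal.ofReal η' ≤ η := by
    obtain ⟨r, hr0, hr⟩ := ENNReal.lt_iff_exists_nnreal_btwn.1 hη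
    refine ⟨r / 2, by simpa using hr0, ?_⟩
    rw [← ENNReal.ofReal_add (by positivity) (by positivity), add_halves, ENNReal.ofReal_coe_nnreal]
    exact hr.le
  obtain ⟨k, hks, hkg, hkc, hki⟩ := hgi.exists_hasCompactSupport_integral_sub_le hη'0
  obtain ⟨B, hB⟩ := hkc.bounded_above_of_compact_support hks
  have hB0 : 0 ≤ B := (norm_nonneg _).trans (hB 0)
  have hd := ENNReal.Tendsto.const_mul (a := ENNReal.ofReal B)
    (tendsto_lintegral_defect hu hu1 hξ hC hε hε0 hρ hK) (Or.inr ENNReal.ofReal_ne_top)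
  rw [mul_zero, ENNReal.tendsto_nhds_zero] at hd
  filter_upwards [hd (ENNReal.ofReal η') (by simpa using hη'0),
    hε0.eventually (gt_mem_nhds hδ)] with n hn hnδ
  refine le_trans ?_ hη'
  have hdiff : Integrable fun y => |g y - k y| := (hgi.sub hki).abs
  have hpt : ∀ x ∈ K, ENNReal.ofReal (defect (ρ n) ξ u x *
      |fderiv ℝ (mollify (ρ n) (component ξ u)) x v|) ≤
      ENNReal.ofReal (mollify (ρ n) (fun y => |g y - k y|) x) +
        ENNReal.ofReal B * ENNReal.ofReal (defect (ρ n) ξ u x) := by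
    intro x hx
    have hsub : Metric.closedBall x (ε n) ⊆ K' :=
      (Metric.closedBall_subset_closedBall hnδ.le).trans (Metric.closedBall_subset_cthickening hx δ)
    rw [(hρ n).fderiv_mollify_of_isWeakDeriv hu hu1 hG hK'c hδΩ (hGK K' hK'c hδΩ) ξ v hsub]
    have hm0 : 0 ≤ mollify (ρ n) (fun y => |g y - k y|) x :=
      integral_nonneg fun y => mul_nonneg (abs_nonneg _) ((hρ n).nonneg _)
    have hw0 := (hρ n).defect_component_nonneg hu hu1 hξ x
    have hw1 : defect (ρ n) ξ u x ≤ 1 := defect_le_one x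
    rw [← ENNReal.ofReal_mul hB0, ← ENNReal.ofReal_add hm0 (by positivity)]
    refine ENNReal.ofReal_le_ofReal ?_
    have hb1 : |mollify (ρ n) g x| ≤ mollify (ρ n) (fun y => |g y - k y|) x + B := by
      have l1 := hdiff.locallyIntegrable
      have l2 : LocallyIntegrable fun y => |g y - k y| + B := l1.add (locallyIntegrable_const B)
      have l3 : LocallyIntegrable fun y => (-1 : ℝ) * (|g y - k y| + B) := l2.smul (-1 : ℝ)
      have e : mollify (ρ n) (fun y => |g y - k y| + B) x =
          mollify (ρ n) (fun y => |g y - k y|) x + B := by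
        rw [(hρ n).mollify_add l1 (locallyIntegrable_const B), (hρ n).mollify_const]
      have hgk : ∀ y, |g y| ≤ |g y - k y| + B := by
        intro y
        have h1 := abs_add_le (g y - k y) (k y)
        rw [sub_add_cancel] at h1
        have h2 := hB y
        rw [Real.norm_eq_abs] at h2
        linarith
      rw [← e, abs_le]
      constructor
      · have h3 : mollify (ρ n) (fun y => (-1) * (|g y - k y| + B)) x ≤ mollify (ρ n) g x :=
          (hρ n).mollify_mono l3 hgi.locallyIntegrable
            (fun y => by have := abs_le.1 (hgk y); linarith) x
        rw [IsMollifier.mollify_const_mul] at h3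
        linarith
      · exact (hρ n).mollify_mono hgi.locallyIntegrable l2
          (fun y => (le_abs_self _).trans (hgk y)) x
    calc defect (ρ n) ξ u x * |mollify (ρ n) g x|
        ≤ defect (ρ n) ξ u x * (mollify (ρ n) (fun y => |g y - k y|) x + B) :=
          mul_le_mul_of_nonneg_left hb1 hw0
      _ ≤ mollify (ρ n) (fun y => |g y - k y|) x + B * defect (ρ n) ξ u x := by nlinarith
  have hmeas : Measurable fun x => ENNReal.ofReal (mollify (ρ n) (fun y => |g y - k y|) x) :=
    ENNReal.measurable_ofReal.comp
      ((hρ n).contDiff_mollify hdiff.locallyIntegrable).continuous.measurable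
  calc ∫⁻ x in K, ENNReal.ofReal (defect (ρ n) ξ u x *
      |fderiv ℝ (mollify (ρ n) (component ξ u)) x v|)
      ≤ ∫⁻ x in K, (ENNReal.ofReal (mollify (ρ n) (fun y => |g y - k y|) x) +
        ENNReal.ofReal B * ENNReal.ofReal (defect (ρ n) ξ u x)) :=
        setLIntegral_mono' hK.measurableSet hpt
    _ = (∫⁻ x in K, ENNReal.ofReal (mollify (ρ n) (fun y => |g y - k y|) x)) +
        ENNReal.ofReal B * ∫⁻ x in K, ENNReal.ofReal (defect (ρ n) ξ u x) := by
        rw [lintegral_add_left hmeas, lintegral_const_mul]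
        exact ENNReal.measurable_ofReal.comp (continuous_defect (hρ n) hu hu1 ξ).measurable
    _ ≤ ENNReal.ofReal η' + ENNReal.ofReal η' := by
        refine add_le_add ?_ hn
        refine (setLIntegral_le_lintegral _ _).trans ?_
        rw [(hρ n).lintegral_mollify hdiff fun y => abs_nonneg _]
        refine ENNReal.ofReal_le_ofReal ?_
        simpa [Real.norm_eq_abs] using hkg

end

/-! ### Smooth entropies and their production -/

/-- The regularised inverse modulus `1 / √(s² + δ²)`. -/
noncomputable def invMod (δ s : ℝ) : ℝ := (√(s ^ 2 + δ ^ 2))⁻¹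

/-- The first component of a smooth entropy for the eikonal equation, which is close to
`(s, t) ↦ (sign s, 0)` on the unit circle. -/
noncomputable def entropyFst (δ s : ℝ) : ℝ := (1 + δ ^ 2) * (s * invMod δ s)

/-- The second component of the smooth entropy with first component `entropyFst`. -/
noncomputable def entropySnd (δ s t : ℝ) : ℝ :=
  δ ^ 2 * (t * invMod δ s) - δ ^ 2 / 2 * (invMod δ s ^ 3 * (t * (1 - s ^ 2 - t ^ 2)))

section

variable {δ : ℝ}

theorem invMod_pos (hδ : 0 < δ) (s : ℝ) : 0 < invMod δ s := by unfold invMod; positivity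

theorem invMod_sq (hδ : 0 < δ) (s : ℝ) : invMod δ s ^ 2 * (s ^ 2 + δ ^ 2) = 1 := by
  unfold invMod
  rw [inv_pow, Real.sq_sqrt (by positivity)]
  exact inv_mul_cancel₀ (by positivity)

theorem invMod_le (hδ : 0 < δ) (s : ℝ) : invMod δ s ≤ δ⁻¹ := by
  unfold invMod
  refine inv_anti₀ hδ (Real.le_sqrt_of_sq_le ?_)
  nlinarith [sq_nonneg s]

theorem abs_mul_invMod_le (hδ : 0 < δ) (s : ℝ) : |s * invMod δ s| ≤ 1 := by
  rw [← sq_le_one_iff_abs_le_one, mul_pow]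
  nlinarith [invMod_sq hδ s, mul_nonneg (sq_nonneg (invMod δ s)) (sq_nonneg δ)]

theorem contDiff_invMod (hδ : 0 < δ) : ContDiff ℝ ∞ (invMod δ) := by
  have h : ∀ s : ℝ, s ^ 2 + δ ^ 2 ≠ 0 := fun s => by positivity
  unfold invMod
  exact (((contDiff_id.pow 2).add contDiff_const).sqrt h).inv
    fun s => by have : 0 < s ^ 2 + δ ^ 2 := by positivity
                exact (Real.sqrt_pos.2 this).ne'

theorem hasDerivAt_invMod (hδ : 0 < δ) {A : ℝ → ℝ} {A' t : ℝ} (hA : HasDerivAt A A' t) :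
    HasDerivAt (fun t => invMod δ (A t)) (-(A t * A') * invMod δ (A t) ^ 3) t := by
  have hpos : 0 < A t ^ 2 + δ ^ 2 := by positivity
  have h1 : HasDerivAt (fun t => A t ^ 2 + δ ^ 2) (2 * A t * A') t := by
    simpa using (hA.pow 2).add_const (δ ^ 2)
  have h2 := (h1.sqrt hpos.ne').inv (Real.sqrt_pos.2 hpos).ne'
  refine HasDerivAt.congr_deriv (f := fun t => invMod δ (A t)) h2 ?_
  have := (Real.sqrt_pos.2 hpos).ne'
  unfold invMod
  field_simp

theorem hasDerivAt_entropyFst (hδ : 0 < δ) {A : ℝ → ℝ} {A' t : ℝ} (hA : HasDerivAt A A' t) :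
    HasDerivAt (fun t => entropyFst δ (A t)) ((1 + δ ^ 2) * (A' * invMod δ (A t) +
      A t * (-(A t * A') * invMod δ (A t) ^ 3))) t :=
  (hA.mul (hasDerivAt_invMod hδ hA)).const_mul _

theorem hasDerivAt_entropySnd (hδ : 0 < δ) {A B : ℝ → ℝ} {A' B' t : ℝ} (hA : HasDerivAt A A' t)
    (hB : HasDerivAt B B' t) :
    HasDerivAt (fun t => entropySnd δ (A t) (B t))
      (δ ^ 2 * (B' * invMod δ (A t) + B t * (-(A t * A') * invMod δ (A t) ^ 3)) -
        δ ^ 2 / 2 * (3 * invMod δ (A t) ^ 2 * (-(A t * A') * invMod δ (A t) ^ 3) *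
          (B t * (1 - A t ^ 2 - B t ^ 2)) + invMod δ (A t) ^ 3 *
          (B' * (1 - A t ^ 2 - B t ^ 2) + B t * (-(2 * A t * A') - 2 * B t * B')))) t := by
  have hR := hasDerivAt_invMod hδ hA
  have hw : HasDerivAt (fun t => 1 - A t ^ 2 - B t ^ 2) (-(2 * A t * A') - 2 * B t * B') t := by
    exact (((hA.pow 2).const_sub 1).sub (hB.pow 2)).congr_deriv (by simp)
  have hR3 : HasDerivAt (fun t => invMod δ (A t) ^ 3)
      (3 * invMod δ (A t) ^ 2 * (-(A t * A') * invMod δ (A t) ^ 3)) t := by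
    exact (hR.pow 3).congr_deriv (by simp)
  exact ((hB.mul hR).const_mul _).sub ((hR3.mul (hB.mul hw)).const_mul _)

theorem hasDerivAt_line {f : Plane → ℝ} {x : Plane} (hf : DifferentiableAt ℝ f x) (v : Plane) :
    HasDerivAt (fun t : ℝ => f (x + t • v)) (fderiv ℝ f x v) 0 :=
  hf.hasFDerivAt.hasLineDerivAt v

theorem contDiff_entropyFst (hδ : 0 < δ) {a : Plane → ℝ} (ha : ContDiff ℝ ∞ a) :
    ContDiff ℝ ∞ fun x => entropyFst δ (a x) :=
  contDiff_const.mul (ha.mul ((contDiff_invMod hδ).comp ha))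

theorem contDiff_entropySnd (hδ : 0 < δ) {a b : Plane → ℝ} (ha : ContDiff ℝ ∞ a)
    (hb : ContDiff ℝ ∞ b) : ContDiff ℝ ∞ fun x => entropySnd δ (a x) (b x) := by
  have hR := (contDiff_invMod hδ).comp ha
  exact (contDiff_const.mul (hb.mul hR)).sub (contDiff_const.mul
    ((hR.pow 3).mul (hb.mul ((contDiff_const.sub (ha.pow 2)).sub (hb.pow 2)))))

/-- Entropy production of a smooth divergence-free field: a multiple of its defect of length. -/
theorem entropy_production (hδ : 0 < δ) {a b : Plane → ℝ} (ha : ContDiff ℝ ∞ a)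
    (hb : ContDiff ℝ ∞ b) {x ξ η : Plane} (hdiv : fderiv ℝ a x ξ + fderiv ℝ b x η = 0) :
    fderiv ℝ (fun x => entropyFst δ (a x)) x ξ + fderiv ℝ (fun x => entropySnd δ (a x) (b x)) x η =
      (1 - a x ^ 2 - b x ^ 2) * (3 / 2 * δ ^ 2 * invMod δ (a x) ^ 3 * fderiv ℝ a x ξ +
        3 / 2 * δ ^ 2 * invMod δ (a x) ^ 5 * (a x * b x) * fderiv ℝ a x η) := by
  have hda : DifferentiableAt ℝ a x := ha.differentiable (by simp) x
  have hdb : DifferentiableAt ℝ b x := hb.differentiable (by simp) x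
  have e1 : fderiv ℝ (fun x => entropyFst δ (a x)) x ξ = _ :=
    (hasDerivAt_line ((contDiff_entropyFst hδ ha).differentiable (by simp) x) ξ).unique
      (hasDerivAt_entropyFst hδ (hasDerivAt_line hda ξ))
  have e2 : fderiv ℝ (fun x => entropySnd δ (a x) (b x)) x η = _ :=
    (hasDerivAt_line ((contDiff_entropySnd hδ ha hb).differentiable (by simp) x) η).unique
      (hasDerivAt_entropySnd hδ (hasDerivAt_line hda η) (hasDerivAt_line hdb η))
  rw [e1, e2]
  simp only [zero_smul, add_zero]
  have hR := invMod_sq hδ (a x)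
  have hb2 : fderiv ℝ b x η = -fderiv ℝ a x ξ := by linarith
  rw [hb2]
  generalize fderiv ℝ a x ξ = a1
  generalize fderiv ℝ a x η = a2
  generalize invMod δ (a x) = R at *
  -- Without its second term, `entropySnd` would leave `t` times the derivative along `η` of `1 - s
  -- ^ 2 - t ^ 2`, up to the factor `δ ^ 2 / 2 * R ^ 3`. The correction cancels this and vanishes on
  -- the unit circle.
  linear_combination (-a1 * R) * hR

/-- For fixed `δ` the coefficients are bounded, so the production is controlled by the vanishing
products of defect and derivative. The constant blows up as `δ` tends to 0, so the mollification
limit comes first. -/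
theorem abs_entropy_production_le (hδ : 0 < δ) {s t w p q : ℝ} (hs : |s| ≤ 1) (ht : |t| ≤ 1)
    (hw : 0 ≤ w) :
    |w * (3 / 2 * δ ^ 2 * invMod δ s ^ 3 * p + 3 / 2 * δ ^ 2 * invMod δ s ^ 5 * (s * t) * q)| ≤
      3 / 2 * δ ^ 2 * (δ⁻¹ ^ 3 + δ⁻¹ ^ 5) * (w * |p| + w * |q|) := by
  have R0 := (invMod_pos hδ s).le
  have hR := invMod_le hδ s
  have h3 : invMod δ s ^ 3 ≤ δ⁻¹ ^ 3 := pow_le_pow_left₀ R0 hR 3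
  have h5 : invMod δ s ^ 5 ≤ δ⁻¹ ^ 5 := pow_le_pow_left₀ R0 hR 5
  have d3 : 0 < δ⁻¹ ^ 3 := by positivity
  have d5 : 0 < δ⁻¹ ^ 5 := by positivity
  have hst : |s * t| ≤ 1 := by
    rw [abs_mul]; exact mul_le_one₀ hs (abs_nonneg _) ht
  rw [abs_mul, abs_of_nonneg hw]
  have k1 : |3 / 2 * δ ^ 2 * invMod δ s ^ 3 * p| ≤ 3 / 2 * δ ^ 2 * (δ⁻¹ ^ 3 + δ⁻¹ ^ 5) * |p| := by
    rw [abs_mul, abs_of_nonneg (by positivity)]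
    gcongr
    linarith
  have k2 : |3 / 2 * δ ^ 2 * invMod δ s ^ 5 * (s * t) * q| ≤
      3 / 2 * δ ^ 2 * (δ⁻¹ ^ 3 + δ⁻¹ ^ 5) * |q| := by
    rw [abs_mul, abs_mul, abs_of_nonneg (by positivity : 0 ≤ 3 / 2 * δ ^ 2 * invMod δ s ^ 5)]
    refine mul_le_mul_of_nonneg_right ?_ (abs_nonneg _)
    calc 3 / 2 * δ ^ 2 * invMod δ s ^ 5 * |s * t| ≤ 3 / 2 * δ ^ 2 * invMod δ s ^ 5 * 1 := by gcongr
      _ ≤ 3 / 2 * δ ^ 2 * (δ⁻¹ ^ 3 + δ⁻¹ ^ 5) := by rw [mul_one]; gcongr; linarith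
  calc w * |3 / 2 * δ ^ 2 * invMod δ s ^ 3 * p + 3 / 2 * δ ^ 2 * invMod δ s ^ 5 * (s * t) * q|
      ≤ w * (3 / 2 * δ ^ 2 * (δ⁻¹ ^ 3 + δ⁻¹ ^ 5) * |p| +
        3 / 2 * δ ^ 2 * (δ⁻¹ ^ 3 + δ⁻¹ ^ 5) * |q|) := by
        refine mul_le_mul_of_nonneg_left ((abs_add_le _ _).trans (add_le_add k1 k2)) hw
    _ = _ := by ring

theorem abs_entropyFst_le (hδ : 0 < δ) (s : ℝ) : |entropyFst δ s| ≤ 1 + δ ^ 2 := by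
  rw [entropyFst, abs_mul, abs_of_nonneg (by positivity)]
  exact mul_le_of_le_one_right (by positivity) (abs_mul_invMod_le hδ s)

theorem abs_entropySnd_le (hδ : 0 < δ) {s t : ℝ} (h : s ^ 2 + t ^ 2 ≤ 1) :
    |entropySnd δ s t| ≤ δ ^ 2 * δ⁻¹ + δ ^ 2 / 2 * δ⁻¹ ^ 3 := by
  have ht : |t| ≤ 1 := by
    rw [← sq_le_one_iff_abs_le_one]; nlinarith [sq_nonneg s]
  have R0 := (invMod_pos hδ s).le
  have hR := invMod_le hδ s
  have h3 : invMod δ s ^ 3 ≤ δ⁻¹ ^ 3 := pow_le_pow_left₀ R0 hR 3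
  have d3 : 0 < δ⁻¹ ^ 3 := by positivity
  have hw : |t * (1 - s ^ 2 - t ^ 2)| ≤ 1 := by
    rw [abs_mul]
    refine mul_le_one₀ ht (abs_nonneg _) ?_
    rw [abs_le]; constructor <;> nlinarith [sq_nonneg s, sq_nonneg t]
  refine (abs_sub _ _).trans (add_le_add ?_ ?_)
  · rw [abs_mul, abs_mul, abs_of_nonneg (sq_nonneg δ), abs_of_nonneg R0]
    refine mul_le_mul_of_nonneg_left ?_ (by positivity)
    calc |t| * invMod δ s ≤ 1 * δ⁻¹ := by gcongr
      _ = δ⁻¹ := one_mul _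
  · rw [abs_mul, abs_mul, abs_of_nonneg (by positivity : 0 ≤ δ ^ 2 / 2),
      abs_of_nonneg (pow_nonneg R0 3)]
    refine mul_le_mul_of_nonneg_left ?_ (by positivity)
    calc invMod δ s ^ 3 * |t * (1 - s ^ 2 - t ^ 2)| ≤ δ⁻¹ ^ 3 * 1 := by gcongr
      _ = δ⁻¹ ^ 3 := mul_one _

end

/-! ### Limits in the mollification and in the entropy: the kinetic equation -/

section

variable {Ω : Set Plane} {u : Plane → Plane} {ξ : Plane} {C ε : ℝ} {ρ : Plane → ℝ}

/-- The reflected mollifier centred at `x` is itself a test function, and the divergence does not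
depend on the orthonormal frame. -/
theorem IsMollifier.div_mollify_eq_zero (h : IsMollifier C ε ρ) (hu : Measurable u)
    (hu1 : ∀ x, ‖u x‖ = 1) (hdiv : IsDivFree Ω u) (hξ : ‖ξ‖ = 1) {x : Plane}
    (hx : Metric.closedBall x ε ⊆ Ω) :
    fderiv ℝ (mollify ρ (component ξ u)) x ξ +
      fderiv ℝ (mollify ρ (component (perp ξ) u)) x (perp ξ) = 0 := by
  have l1 := locallyIntegrable_component hu hu1 ξ
  have l2 := locallyIntegrable_component hu hu1 (perp ξ)
  rw [h.fderiv_mollify l1, h.fderiv_mollify l2, ← integral_add (h.integrable_mul_fderiv l1 x ξ)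
    (h.integrable_mul_fderiv l2 x _)]
  have hd := hdiv _ (h.isTestFunction hx)
  simp only [h.fderiv_reflect] at hd
  rw [setIntegral_eq_integral_of_forall_compl_eq_zero (fun y hy => by
      rw [h.fderiv_eq_zero_of_notMem fun hm => hy (hx hm)]; simp), integral_neg, neg_eq_zero] at hd
  rw [← hd]
  congr 1
  funext y
  conv_rhs => rw [← frame_expansion hξ (u y)]
  simp [component]

/-- Integration by parts against a test function. -/
theorem IsTestFunction.integral_fderiv_mul {ζ : Plane → ℝ} (hζ : IsTestFunction Ω ζ)
    {f : Plane → ℝ} (hf : ContDiff ℝ ∞ f) (v : Plane) :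
    ∫ x, fderiv ℝ ζ x v * f x = -∫ x, ζ x * fderiv ℝ f x v := by
  have c1 : Continuous fun x => fderiv ℝ ζ x v :=
    (hζ.smooth.continuous_fderiv (by simp)).clm_apply continuous_const
  have c2 : Continuous fun x => fderiv ℝ f x v :=
    (hf.continuous_fderiv (by simp)).clm_apply continuous_const
  have s1 : HasCompactSupport fun x => fderiv ℝ ζ x v := hζ.compact_support.fderiv_apply ℝ v
  have := integral_mul_fderiv_eq_neg_fderiv_mul_of_integrable (μ := volume) (f := ζ) (g := f)
    (v := v) ((c1.mul hf.continuous).integrable_of_hasCompactSupport s1.mul_right)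
    ((hζ.smooth.continuous.mul c2).integrable_of_hasCompactSupport hζ.compact_support.mul_right)
    ((hζ.smooth.continuous.mul hf.continuous).integrable_of_hasCompactSupport
      hζ.compact_support.mul_right)
    (fun x _ => hζ.smooth.differentiable (by simp) x) (fun x _ => hf.differentiable (by simp) x)
  rw [this, neg_neg]

theorem exists_mollifier_sequence : ∃ (C : ℝ) (ε : ℕ → ℝ) (ρ : ℕ → Plane → ℝ), 0 ≤ C ∧
    (∀ n, 0 < ε n) ∧ Filter.Tendsto ε Filter.atTop (𝓝 0) ∧ ∀ n, IsMollifier C (ε n) (ρ n) := by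
  obtain ⟨C, hC, h⟩ := exists_isMollifier
  have hpos : ∀ n : ℕ, 0 < 1 / ((n : ℝ) + 1) := fun n => by positivity
  choose ρ hρ using fun n : ℕ => h _ (hpos n)
  exact ⟨C, _, ρ, hC.le, hpos, tendsto_one_div_add_atTop_nhds_zero_nat, hρ⟩

end

section

variable {Ω : Set Plane} {u : Plane → Plane} {ξ : Plane}

theorem IsMollifier.mollify_sq_add_sq_le {C ε : ℝ} {ρ : Plane → ℝ} (h : IsMollifier C ε ρ)
    (hu : Measurable u) (hu1 : ∀ x, ‖u x‖ = 1) (hξ : ‖ξ‖ = 1) (x : Plane) :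
    mollify ρ (component ξ u) x ^ 2 + mollify ρ (component (perp ξ) u) x ^ 2 ≤ 1 := by
  have := h.defect_component_nonneg hu hu1 hξ x
  unfold defect at this
  linarith

/-- The smooth entropies of the mollified fields have vanishing production in the limit. -/
theorem tendsto_integral_entropy_mollify (hΩ : IsOpen Ω) (hu : Measurable u)
    (hu1 : ∀ x, ‖u x‖ = 1) (hdiv : IsDivFree Ω u) (hcomm : CommutatorVanishes Ω u)
    (hξ : ‖ξ‖ = 1) {δ : ℝ} (hδ : 0 < δ) {ζ : Plane → ℝ} (hζ : IsTestFunction Ω ζ)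
    {C : ℝ} {ε : ℕ → ℝ} {ρ : ℕ → Plane → ℝ} (hC : 0 ≤ C) (hε : ∀ n, 0 < ε n)
    (hε0 : Filter.Tendsto ε Filter.atTop (𝓝 0)) (hρ : ∀ n, IsMollifier C (ε n) (ρ n)) :
    Filter.Tendsto (fun n => ∫ x,
      (fderiv ℝ ζ x ξ * entropyFst δ (mollify (ρ n) (component ξ u) x) +
        fderiv ℝ ζ x (perp ξ) * entropySnd δ (mollify (ρ n) (component ξ u) x)
          (mollify (ρ n) (component (perp ξ) u) x))) Filter.atTop (𝓝 0) := by
  set K := tsupport ζ with hKdef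
  have hK : IsCompact K := hζ.compact_support
  -- Room around the support of `ζ`: for small `ε n` the mollified field is divergence free at every
  -- point that matters.
  obtain ⟨τ, hτ, hτΩ⟩ := hK.exists_cthickening_subset_open hΩ hζ.support_subset
  obtain ⟨B, hB⟩ := hζ.smooth.continuous.bounded_above_of_compact_support hζ.compact_support
  have hB0 : 0 ≤ B := (norm_nonneg _).trans (hB 0)
  set M := B * (3 / 2 * δ ^ 2 * (δ⁻¹ ^ 3 + δ⁻¹ ^ 5)) with hM
  have hM0 : 0 ≤ M := by positivity
  have t1 := hcomm C ε ρ hC hε hε0 hρ ξ hξ ξ K hζ.support_subset hK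
  have t2 := hcomm C ε ρ hC hε hε0 hρ ξ hξ (perp ξ) K hζ.support_subset hK
  have t3 := ENNReal.Tendsto.const_mul (a := ENNReal.ofReal M) (t1.add t2)
    (Or.inr ENNReal.ofReal_ne_top)
  rw [add_zero, mul_zero] at t3
  have t4 := (ENNReal.tendsto_toReal ENNReal.zero_ne_top).comp t3
  rw [ENNReal.toReal_zero] at t4
  refine squeeze_zero_norm' ?_ t4
  filter_upwards [hε0.eventually (gt_mem_nhds hτ),
    ENNReal.tendsto_nhds_zero.1 t3 1 one_pos] with n hn hfin
  set a := mollify (ρ n) (component ξ u) with ha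
  set b := mollify (ρ n) (component (perp ξ) u) with hb
  have hac : ContDiff ℝ ∞ a := (hρ n).contDiff_mollify (locallyIntegrable_component hu hu1 _)
  have hbc : ContDiff ℝ ∞ b := (hρ n).contDiff_mollify (locallyIntegrable_component hu hu1 _)
  have hP := contDiff_entropyFst hδ hac
  have hQ := contDiff_entropySnd hδ hac hbc
  have cont : ∀ {f : Plane → ℝ} (_ : ContDiff ℝ ∞ f) (v : Plane),
      Continuous fun x => fderiv ℝ f x v := fun hf v =>
    (hf.continuous_fderiv (by simp)).clm_apply continuous_const
  have i1 : ∀ {f : Plane → ℝ} (_ : Continuous f) (v : Plane),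
      Integrable fun x => fderiv ℝ ζ x v * f x := fun hf v =>
    ((cont hζ.smooth v).mul hf).integrable_of_hasCompactSupport
      (hζ.compact_support.fderiv_apply ℝ v).mul_right
  have i2 : ∀ {f : Plane → ℝ} (_ : Continuous f), Integrable fun x => ζ x * f x := fun hf =>
    (hζ.smooth.continuous.mul hf).integrable_of_hasCompactSupport hζ.compact_support.mul_right
  rw [integral_add (i1 hP.continuous ξ) (i1 hQ.continuous (perp ξ)), hζ.integral_fderiv_mul hP,
    hζ.integral_fderiv_mul hQ, ← neg_add,
    ← integral_add (i2 (cont hP ξ)) (i2 (cont hQ (perp ξ))), norm_neg]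
  refine (norm_integral_le_lintegral_norm _).trans ?_
  refine ENNReal.toReal_mono (ne_top_of_le_ne_top ENNReal.one_ne_top hfin) ?_
  have hpt : ∀ x, ENNReal.ofReal ‖ζ x * fderiv ℝ (fun x => entropyFst δ (a x)) x ξ +
      ζ x * fderiv ℝ (fun x => entropySnd δ (a x) (b x)) x (perp ξ)‖ ≤
      K.indicator (fun x => ENNReal.ofReal M *
        (ENNReal.ofReal (defect (ρ n) ξ u x * |fderiv ℝ a x ξ|) +
          ENNReal.ofReal (defect (ρ n) ξ u x * |fderiv ℝ a x (perp ξ)|))) x := by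
    intro x
    by_cases hx : x ∈ K
    · rw [Set.indicator_of_mem hx]
      have hsub : Metric.closedBall x (ε n) ⊆ Ω :=
        ((Metric.closedBall_subset_closedBall hn.le).trans
          (Metric.closedBall_subset_cthickening hx τ)).trans hτΩ
      have hd := (hρ n).div_mollify_eq_zero hu hu1 hdiv hξ hsub
      have hw := (hρ n).defect_component_nonneg hu hu1 hξ x
      rw [← ENNReal.ofReal_add (by positivity) (by positivity), ← ENNReal.ofReal_mul hM0,
        ← mul_add, entropy_production hδ hac hbc hd, norm_mul]
      refine ENNReal.ofReal_le_ofReal ?_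
      have hab := (hρ n).mollify_sq_add_sq_le hu hu1 hξ x
      rw [← ha, ← hb] at hab
      have ha1 : |a x| ≤ 1 := by
        rw [← sq_le_one_iff_abs_le_one]; nlinarith [sq_nonneg (b x)]
      have hb1 : |b x| ≤ 1 := by
        rw [← sq_le_one_iff_abs_le_one]; nlinarith [sq_nonneg (a x)]
      rw [hM, mul_assoc B]
      exact mul_le_mul (hB x) (abs_entropy_production_le hδ ha1 hb1 hw) (norm_nonneg _) hB0
    · rw [Set.indicator_of_notMem hx, image_eq_zero_of_notMem_tsupport hx]; simp
  refine (lintegral_mono hpt).trans ?_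
  rw [lintegral_indicator hK.measurableSet]
  have m1 : Measurable fun x => ENNReal.ofReal (defect (ρ n) ξ u x * |fderiv ℝ a x ξ|) :=
    ENNReal.measurable_ofReal.comp
      ((continuous_defect (hρ n) hu hu1 ξ).mul (cont hac ξ).abs).measurable
  rw [lintegral_const_mul' _ _ ENNReal.ofReal_ne_top, lintegral_add_left m1]

theorem continuous_invMod {δ : ℝ} (hδ : 0 < δ) : Continuous (invMod δ) :=
  (contDiff_invMod hδ).continuous

theorem continuous_entropySnd {δ : ℝ} (hδ : 0 < δ) :
    Continuous fun z : ℝ × ℝ => entropySnd δ z.1 z.2 := by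
  have := (continuous_invMod hδ).comp (continuous_fst (X := ℝ) (Y := ℝ))
  unfold entropySnd
  exact (continuous_const.mul (continuous_snd.mul this)).sub (continuous_const.mul
    ((this.pow 3).mul (continuous_snd.mul ((continuous_const.sub (continuous_fst.pow 2)).sub
      (continuous_snd.pow 2)))))

theorem continuous_entropyFst {δ : ℝ} (hδ : 0 < δ) : Continuous (entropyFst δ) :=
  continuous_const.mul (continuous_id.mul (continuous_invMod hδ))

/-- The entropy equation for `u`. -/
theorem integral_entropy_eq_zero (hΩ : IsOpen Ω) (hu : Measurable u)
    (hu1 : ∀ x, ‖u x‖ = 1) (hdiv : IsDivFree Ω u) (hcomm : CommutatorVanishes Ω u)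
    (hξ : ‖ξ‖ = 1) {δ : ℝ} (hδ : 0 < δ) {ζ : Plane → ℝ} (hζ : IsTestFunction Ω ζ) :
    ∫ x, (fderiv ℝ ζ x ξ * entropyFst δ (component ξ u x) +
        fderiv ℝ ζ x (perp ξ) * entropySnd δ (component ξ u x) (component (perp ξ) u x)) = 0 := by
  obtain ⟨C, ε, ρ, hC, hε, hε0, hρ⟩ := exists_mollifier_sequence
  refine tendsto_nhds_unique ?_
    (tendsto_integral_entropy_mollify hΩ hu hu1 hdiv hcomm hξ hδ hζ hC hε hε0 hρ)
  have cont : ∀ v : Plane, Continuous fun x => fderiv ℝ ζ x v := fun v =>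
    (hζ.smooth.continuous_fderiv (by simp)).clm_apply continuous_const
  have int : ∀ v : Plane, Integrable fun x => |fderiv ℝ ζ x v| := fun v =>
    ((cont v).integrable_of_hasCompactSupport (hζ.compact_support.fderiv_apply ℝ v)).abs
  have hac : ∀ n η, Continuous (mollify (ρ n) (component η u)) := fun n η =>
    ((hρ n).contDiff_mollify (locallyIntegrable_component hu hu1 η)).continuous
  refine tendsto_integral_of_dominated_convergence
    (fun x => |fderiv ℝ ζ x ξ| * (1 + δ ^ 2) +
      |fderiv ℝ ζ x (perp ξ)| * (δ ^ 2 * δ⁻¹ + δ ^ 2 / 2 * δ⁻¹ ^ 3)) (fun n => ?_)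
    (((int ξ).mul_const _).add ((int (perp ξ)).mul_const _)) (fun n => ?_) ?_
  · refine Continuous.aestronglyMeasurable ?_
    exact ((cont ξ).mul ((continuous_entropyFst hδ).comp (hac n ξ))).add
      ((cont _).mul ((continuous_entropySnd hδ).comp ((hac n ξ).prodMk (hac n (perp ξ)))))
  · refine Filter.Eventually.of_forall fun x => ?_
    refine (norm_add_le _ _).trans (add_le_add ?_ ?_)
    · rw [norm_mul]
      exact mul_le_mul_of_nonneg_left (abs_entropyFst_le hδ _) (abs_nonneg _)
    · rw [norm_mul]
      exact mul_le_mul_of_nonneg_left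
        (abs_entropySnd_le hδ ((hρ n).mollify_sq_add_sq_le hu hu1 hξ x)) (abs_nonneg _)
  · filter_upwards [ae_isLebesguePoint (locallyIntegrable_of_norm_eq_one hu hu1)] with x hx
    have h1 := tendsto_mollify_component hu hu1 hx hC hε hε0 hρ ξ
    have h2 := tendsto_mollify_component hu hu1 hx hC hε hε0 hρ (perp ξ)
    refine (Filter.Tendsto.const_mul _ ?_).add (Filter.Tendsto.const_mul _ ?_)
    · exact (continuous_entropyFst hδ).continuousAt.tendsto.comp h1
    · exact (continuous_entropySnd hδ).continuousAt.tendsto.comp (h1.prodMk_nhds h2)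

/-- The quotient `s / |s|` is the sign function, including the value 0 at 0 since division by zero
gives 0. -/
theorem tendsto_mul_invMod {δ : ℕ → ℝ} (hδ : Filter.Tendsto δ Filter.atTop (𝓝 0)) (s : ℝ) :
    Filter.Tendsto (fun n => s * invMod (δ n) s) Filter.atTop (𝓝 (s / |s|)) := by
  rcases eq_or_ne s 0 with rfl | hs
  · simp
  · rw [div_eq_mul_inv]
    refine Filter.Tendsto.const_mul _ ?_
    unfold invMod
    refine Filter.Tendsto.inv₀ ?_ (abs_ne_zero.2 hs)
    have h1 : Filter.Tendsto (fun n => s ^ 2 + δ n ^ 2) Filter.atTop (𝓝 (s ^ 2 + 0 ^ 2)) :=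
      tendsto_const_nhds.add (hδ.pow 2)
    have h2 := (Real.continuous_sqrt.tendsto _).comp h1
    simpa [Real.sqrt_sq_eq_abs, Function.comp_def] using h2

/-- The kinetic equation `ξ · ∇ sign (ξ · u) = 0`. -/
theorem integral_fderiv_mul_sign_eq_zero (hΩ : IsOpen Ω) (hu : Measurable u)
    (hu1 : ∀ x, ‖u x‖ = 1) (hdiv : IsDivFree Ω u) (hcomm : CommutatorVanishes Ω u)
    (hξ : ‖ξ‖ = 1) {ζ : Plane → ℝ} (hζ : IsTestFunction Ω ζ) :
    ∫ x, fderiv ℝ ζ x ξ * (component ξ u x / |component ξ u x|) = 0 := by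
  set δ : ℕ → ℝ := fun n => 1 / ((n : ℝ) + 1) with hδdef
  have hδ : ∀ n, 0 < δ n := fun n => by simp only [hδdef]; positivity
  have hδ1 : ∀ n, δ n ≤ 1 := fun n => by
    simp only [hδdef]
    rw [div_le_one (by positivity)]
    have : (0 : ℝ) ≤ n := Nat.cast_nonneg n
    linarith
  have hδ0 : Filter.Tendsto δ Filter.atTop (𝓝 0) := tendsto_one_div_add_atTop_nhds_zero_nat
  have cont : ∀ v : Plane, Continuous fun x => fderiv ℝ ζ x v := fun v =>
    (hζ.smooth.continuous_fderiv (by simp)).clm_apply continuous_const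
  have int : ∀ v : Plane, Integrable fun x => |fderiv ℝ ζ x v| := fun v =>
    ((cont v).integrable_of_hasCompactSupport (hζ.compact_support.fderiv_apply ℝ v)).abs
  -- On the unit circle the correction term of the entropy is zero.
  have hsnd : ∀ n x, entropySnd (δ n) (component ξ u x) (component (perp ξ) u x) =
      δ n ^ 2 * (component (perp ξ) u x * invMod (δ n) (component ξ u x)) := by
    intro n x
    have : 1 - component ξ u x ^ 2 - component (perp ξ) u x ^ 2 = 0 := by
      linarith [component_sq_add_sq hu1 hξ x]
    rw [entropySnd, this]; ring
  -- `δ ^ 2` beats the bound `δ⁻¹` on the inverse modulus, so the transverse flux disappears in the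
  -- limit.
  have hsnd_le : ∀ n x, |entropySnd (δ n) (component ξ u x) (component (perp ξ) u x)| ≤ δ n := by
    intro n x
    rw [hsnd, abs_mul, abs_mul, abs_of_nonneg (sq_nonneg _),
      abs_of_nonneg (invMod_pos (hδ n) _).le]
    have h1 := abs_component_le hu1 (perp ξ) x
    rw [norm_perp, hξ] at h1
    have h2 := invMod_le (hδ n) (component ξ u x)
    have := hδ n
    calc δ n ^ 2 * (|component (perp ξ) u x| * invMod (δ n) (component ξ u x))
        ≤ δ n ^ 2 * (1 * (δ n)⁻¹) := by
          have := invMod_pos (hδ n) (component ξ u x)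
          gcongr
      _ = δ n := by field_simp
  have hmc := measurable_component hu
  refine tendsto_nhds_unique (f := fun n : ℕ => ∫ x, (fderiv ℝ ζ x ξ *
    entropyFst (δ n) (component ξ u x) + fderiv ℝ ζ x (perp ξ) *
      entropySnd (δ n) (component ξ u x) (component (perp ξ) u x))) (l := Filter.atTop) ?_ ?_
  · refine tendsto_integral_of_dominated_convergence
      (fun x => |fderiv ℝ ζ x ξ| * 2 + |fderiv ℝ ζ x (perp ξ)| * 1) (fun n => ?_)
      (((int ξ).mul_const _).add ((int (perp ξ)).mul_const _)) (fun n => ?_) ?_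
    · refine Measurable.aestronglyMeasurable ?_
      exact ((cont ξ).measurable.mul ((continuous_entropyFst (hδ n)).measurable.comp (hmc ξ))).add
        ((cont _).measurable.mul ((continuous_entropySnd (hδ n)).measurable.comp
          ((hmc ξ).prodMk (hmc (perp ξ)))))
    · refine Filter.Eventually.of_forall fun x => ?_
      refine (norm_add_le _ _).trans (add_le_add ?_ ?_)
      · rw [norm_mul]
        refine mul_le_mul_of_nonneg_left ((abs_entropyFst_le (hδ n) _).trans ?_) (abs_nonneg _)
        nlinarith [hδ n, hδ1 n]
      · rw [norm_mul]
        exact mul_le_mul_of_nonneg_left ((hsnd_le n x).trans (hδ1 n)) (abs_nonneg _)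
    · refine Filter.Eventually.of_forall fun x => ?_
      have h1 : Filter.Tendsto (fun n => entropyFst (δ n) (component ξ u x)) Filter.atTop
          (𝓝 ((1 + 0 ^ 2) * (component ξ u x / |component ξ u x|))) :=
        (tendsto_const_nhds.add (hδ0.pow 2)).mul (tendsto_mul_invMod hδ0 _)
      have h2 : Filter.Tendsto (fun n => entropySnd (δ n) (component ξ u x)
          (component (perp ξ) u x)) Filter.atTop (𝓝 0) :=
        squeeze_zero_norm (fun n => hsnd_le n x) hδ0
      have h3 := (h1.const_mul (fderiv ℝ ζ x ξ)).add (h2.const_mul (fderiv ℝ ζ x (perp ξ)))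
      simpa using h3
  · refine tendsto_const_nhds.congr fun n => ?_
    exact (integral_entropy_eq_zero hΩ hu hu1 hdiv hcomm hξ (hδ n) hζ).symm

end

/-! ### From the kinetic equation to the sign rule -/

theorem abs_div_abs_le_one (s : ℝ) : |(s / |s|)| ≤ 1 := by
  rw [abs_div, abs_abs]; exact div_self_le_one _

/-- The sign differs from that of `c` only if `s` is at distance at least `|c|` from `c`. Hence a
Lebesgue point of `u` is one of the sign of a component that does not vanish there. -/
theorem abs_sign_sub_sign_le {c : ℝ} (hc : c ≠ 0) (s : ℝ) :
    |(s / |s| - c / |c|)| ≤ 2 / |c| * |s - c| := by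
  have hcpos : 0 < |c| := abs_pos.2 hc
  rcases lt_or_ge 0 (s * c) with h | h
  · have : s / |s| = c / |c| := by
      rcases pos_and_pos_or_neg_and_neg_of_mul_pos h with ⟨h1, h2⟩ | ⟨h1, h2⟩
      · rw [abs_of_pos h1, abs_of_pos h2, div_self h1.ne', div_self h2.ne']
      · rw [abs_of_neg h1, abs_of_neg h2, div_neg, div_neg, div_self h1.ne, div_self h2.ne]
    rw [this, sub_self, abs_zero]; positivity
  · have h1 : |c| ≤ |s - c| := by
      rw [← sq_le_sq]; nlinarith [sq_nonneg s]
    calc |(s / |s| - c / |c|)| ≤ |(s / |s|)| + |(c / |c|)| := abs_sub _ _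
      _ ≤ 1 + 1 := add_le_add (abs_div_abs_le_one s) (abs_div_abs_le_one c)
      _ = 2 / |c| * |c| := by field_simp; norm_num
      _ ≤ 2 / |c| * |s - c| := by gcongr

section

variable {Ω : Set Plane} {u : Plane → Plane} {ξ : Plane}

theorem measurable_sign_component (hu : Measurable u) (ξ : Plane) :
    Measurable fun x => component ξ u x / |component ξ u x| :=
  (measurable_component hu ξ).div (measurable_component hu ξ).abs

theorem locallyIntegrable_sign_component (hu : Measurable u) (ξ : Plane) :
    LocallyIntegrable fun x => component ξ u x / |component ξ u x| :=
  locallyIntegrable_of_bounded (measurable_sign_component hu ξ) fun _ => abs_div_abs_le_one _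

theorem tendsto_mollify_sign (hu : Measurable u) (hu1 : ∀ x, ‖u x‖ = 1) {x : Plane}
    (hx : IsLebesguePoint u x) {C : ℝ} {ε : ℕ → ℝ} {ρ : ℕ → Plane → ℝ} (hC : 0 ≤ C)
    (hε : ∀ n, 0 < ε n) (hε0 : Filter.Tendsto ε Filter.atTop (𝓝 0))
    (hρ : ∀ n, IsMollifier C (ε n) (ρ n)) (hξ : ‖ξ‖ = 1) (hc : component ξ u x ≠ 0) :
    Filter.Tendsto (fun n => mollify (ρ n) (fun y => component ξ u y / |component ξ u y|) x)
      Filter.atTop (𝓝 (component ξ u x / |component ξ u x|)) := by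
  rw [tendsto_iff_dist_tendsto_zero]
  refine squeeze_zero (fun _ => dist_nonneg) (fun n => ?_)
    (hx.tendsto hε hε0 (C * (2 / |component ξ u x|)))
  rw [Real.dist_eq]
  have hli := locallyIntegrable_sign_component hu ξ
  refine ((hρ n).abs_mollify_sub_le hli _ x).trans ?_
  rw [mul_div_right_comm, mul_assoc]
  have := hε n
  refine mul_le_mul_of_nonneg_left ?_ (by positivity)
  rw [← integral_const_mul]
  refine setIntegral_mono_on ?_ ?_ measurableSet_closedBall fun y _ => ?_
  · exact (IsMollifier.integrableOn_closedBall (hli.sub (locallyIntegrable_const _)) x).abs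
  · have := integrableOn_norm_sub_pow hu hu1 x (ε n) 1
    simp only [pow_one] at this
    exact this.const_mul _
  · refine (abs_sign_sub_sign_le hc _).trans (mul_le_mul_of_nonneg_left ?_ (by positivity))
    simp only [component, ← inner_sub_right]
    simpa [hξ] using abs_real_inner_le_norm ξ (u y - u x)

/-- With `ξ` the direction of `y - x`, the mollified sign of `ξ · u` is constant along the segment
by the kinetic equation. At the end points it converges to the true signs, provided these are
nonzero. -/
theorem sign_rule (hΩ : IsOpen Ω) (hu : Measurable u) (hu1 : ∀ x, ‖u x‖ = 1)
    (hdiv : IsDivFree Ω u) (hcomm : CommutatorVanishes Ω u) {x y : Plane}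
    (hx : IsLebesguePoint u x) (hy : IsLebesguePoint u y) (hseg : segment ℝ x y ⊆ Ω) :
    0 ≤ ⟪u x, y - x⟫ * ⟪u y, y - x⟫ := by
  by_contra! hneg
  have hd : y - x ≠ 0 := by intro h0; rw [h0] at hneg; simp at hneg
  have hdpos : 0 < ‖y - x‖ := norm_pos_iff.2 hd
  set ξ : Plane := ‖y - x‖⁻¹ • (y - x) with hξdef
  have hξ : ‖ξ‖ = 1 := by rw [hξdef, norm_smul, norm_inv, norm_norm, inv_mul_cancel₀ hdpos.ne']
  have hcomp : ∀ z, component ξ u z = ‖y - x‖⁻¹ * ⟪u z, y - x⟫ := by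
    intro z; rw [component, hξdef, real_inner_smul_left, real_inner_comm]
  have hprod : component ξ u x * component ξ u y < 0 := by
    rw [hcomp, hcomp]
    have : 0 < ‖y - x‖⁻¹ * ‖y - x‖⁻¹ := by positivity
    nlinarith
  obtain ⟨C, ε, ρ, hC, hε, hε0, hρ⟩ := exists_mollifier_sequence
  have hcx : component ξ u x ≠ 0 := left_ne_zero_of_mul hprod.ne
  have hcy : component ξ u y ≠ 0 := right_ne_zero_of_mul hprod.ne
  have tx := tendsto_mollify_sign hu hu1 hx hC hε hε0 hρ hξ hcx
  have ty := tendsto_mollify_sign hu hu1 hy hC hε hε0 hρ hξ hcy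
  set s : Plane → ℝ := fun y => component ξ u y / |component ξ u y| with hs
  have hli : LocallyIntegrable s := locallyIntegrable_sign_component hu ξ
  have hK : IsCompact (segment ℝ x y) := by
    rw [segment_eq_image_lineMap]
    exact isCompact_Icc.image AffineMap.lineMap_continuous
  obtain ⟨τ, hτ, hτΩ⟩ := hK.exists_cthickening_subset_open hΩ hseg
  have heq : ∀ᶠ n in Filter.atTop, mollify (ρ n) s x = mollify (ρ n) s y := by
    filter_upwards [hε0.eventually (gt_mem_nhds hτ)] with n hn
    have hsm := (hρ n).contDiff_mollify hli
    have hzero : ∀ z ∈ segment ℝ x y, fderiv ℝ (mollify (ρ n) s) z (y - x) = 0 := by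
      intro z hz
      have hsub : Metric.closedBall z (ε n) ⊆ Ω :=
        ((Metric.closedBall_subset_closedBall hn.le).trans
          (Metric.closedBall_subset_cthickening hz τ)).trans hτΩ
      have h1 := integral_fderiv_mul_sign_eq_zero hΩ hu hu1 hdiv hcomm hξ
        ((hρ n).isTestFunction hsub)
      simp only [(hρ n).fderiv_reflect, neg_mul, integral_neg, neg_eq_zero] at h1
      have h2 : fderiv ℝ (mollify (ρ n) s) z ξ = 0 := by
        rw [(hρ n).fderiv_mollify hli, ← h1]
        simp only [mul_comm, hs]
      have h3 : y - x = ‖y - x‖ • ξ := by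
        rw [hξdef, smul_smul, mul_inv_cancel₀ hdpos.ne', one_smul]
      rw [h3, map_smul, h2, smul_zero]
    have hder : ∀ t : ℝ, HasDerivAt (fun t : ℝ => mollify (ρ n) s (x + t • (y - x)))
        (fderiv ℝ (mollify (ρ n) s) (x + t • (y - x)) (y - x)) t := by
      intro t
      have h1 : HasDerivAt (fun t : ℝ => x + t • (y - x)) (y - x) t := by
        simpa using ((hasDerivAt_id t).smul_const (y - x)).const_add x
      exact (hsm.differentiable (by simp) _).hasFDerivAt.comp_hasDerivAt t h1
    have hconst := constant_of_has_deriv_right_zero (a := (0 : ℝ)) (b := 1)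
      (f := fun t : ℝ => mollify (ρ n) s (x + t • (y - x)))
      (fun t _ => (hder t).continuousAt.continuousWithinAt)
      (fun t ht => by
        have := (hder t).hasDerivWithinAt (s := Set.Ici t)
        rwa [hzero] at this
        rw [segment_eq_image']
        exact ⟨t, ⟨ht.1, ht.2.le⟩, rfl⟩) 1 (by simp)
    simpa using hconst.symm
  have hlim := tendsto_nhds_unique (tx.congr' heq) ty
  have h1 : component ξ u x * component ξ u y =
      |component ξ u x| * |component ξ u y| * ((component ξ u x / |component ξ u x|) *
        (component ξ u y / |component ξ u y|)) := by
    have := abs_ne_zero.2 hcx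
    have := abs_ne_zero.2 hcy
    field_simp
  rw [hlim] at h1
  have : 0 ≤ component ξ u x * component ξ u y := by
    rw [h1]; exact mul_nonneg (by positivity) (mul_self_nonneg _)
  linarith

theorem isCharacteristicField (hΩ : IsOpen Ω) (hu : Measurable u) (hu1 : ∀ x, ‖u x‖ = 1)
    (hdiv : IsDivFree Ω u) (hcomm : CommutatorVanishes Ω u) :
    IsCharacteristicField Ω (Ω ∩ {x | IsLebesguePoint u x}) u := by
  have hae := ae_isLebesguePoint (locallyIntegrable_of_norm_eq_one hu hu1)
  refine ⟨fun x _ => hu1 x, ?_, ?_, ?_⟩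
  · exact (Measure.dense_of_ae hae).open_subset_closure_inter hΩ
  · rintro x ⟨-, hx⟩ y ⟨-, hy⟩ hseg
    exact sign_rule hΩ hu hu1 hdiv hcomm hx hy hseg
  · rintro x ⟨hxΩ, hx⟩ e he η hη
    obtain ⟨R, hR, hRΩ⟩ := Metric.isOpen_iff.1 hΩ x hxΩ
    have hepos : 0 < ‖e‖ := norm_pos_iff.2 he
    set f : Plane := ‖e‖⁻¹ • e with hf
    have hf1 : ‖f‖ = 1 := by rw [hf, norm_smul, norm_inv, norm_norm, inv_mul_cancel₀ hepos.ne']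
    set δ : ℕ → ℝ := fun n => 1 / ((n : ℝ) + 1) with hδdef
    have hδ : ∀ n, 0 < δ n := fun n => by simp only [hδdef]; positivity
    have hδ0 : Filter.Tendsto δ Filter.atTop (𝓝 0) := tendsto_one_div_add_atTop_nhds_zero_nat
    have hdist : ∀ j, dist x (x + (3 / 2 * δ j) • f) = 3 / 2 * δ j := by
      intro j
      have := hδ j
      rw [dist_eq_norm, sub_add_cancel_left, norm_neg, norm_smul, hf1, mul_one,
        Real.norm_of_nonneg (by positivity)]
    -- The ball of radius `δ j` centred at distance `3 / 2 * δ j` in direction `f` lies in the open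
    -- half plane ahead of `x`, while its double contains `x`. This is why uncentred Lebesgue points
    -- are used.
    have hlim := hx (fun j => x + (3 / 2 * δ j) • f) δ
      (tendsto_nhdsWithin_iff.2 ⟨hδ0, Filter.Eventually.of_forall hδ⟩)
      (Filter.Eventually.of_forall fun j => by
        rw [Metric.mem_closedBall, hdist]; linarith [hδ j])
    have hev := (hlim.eventually (gt_mem_nhds hη)).and
      (hδ0.eventually (gt_mem_nhds (by positivity : 0 < min R η / 3)))
    obtain ⟨j, hj1, hj2⟩ := hev.exists
    set w := x + (3 / 2 * δ j) • f with hw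
    have hμ : volume.restrict (Metric.closedBall w (δ j)) ≠ 0 := by
      rw [Ne, Measure.restrict_eq_zero]
      exact (Metric.measure_closedBall_pos volume w (hδ j)).ne'
    have hintegrable : Integrable (fun y => ‖u y - u x‖) (volume.restrict (Metric.closedBall w (δ j))) := by
      refine IsMollifier.integrableOn_closedBall (locallyIntegrable_of_bounded (B := 2) ?_ ?_) w
      · exact (hu.sub_const _).norm
      · intro y; rw [abs_norm]; exact norm_sub_le_two hu1 x y
    have hN : volume.restrict (Metric.closedBall w (δ j))
        ({y | IsLebesguePoint u y} ∩ Metric.closedBall w (δ j))ᶜ = 0 := by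
      have h1 : ∀ᵐ y ∂volume.restrict (Metric.closedBall w (δ j)),
          y ∈ {y | IsLebesguePoint u y} ∩ Metric.closedBall w (δ j) := by
        filter_upwards [ae_restrict_of_ae hae, ae_restrict_mem measurableSet_closedBall]
          with y h1 h2 using ⟨h1, h2⟩
      exact mem_ae_iff.1 h1
    have : IsFiniteMeasure (volume.restrict (Metric.closedBall w (δ j))) :=
      ⟨by rw [Measure.restrict_apply_univ]; exact measure_closedBall_lt_top⟩
    -- Some Lebesgue point of the ball has a deviation no larger than the average, which is below
    -- `η`.
    obtain ⟨z, hzN, hz⟩ := exists_notMem_null_le_average hμ hintegrable hN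
    rw [Set.notMem_compl_iff] at hzN
    obtain ⟨hzL, hzB⟩ := hzN
    have hzx : ‖z - x‖ < min R η := by
      rw [← dist_eq_norm]
      have h1 := dist_triangle z w x
      rw [dist_comm w x, hdist] at h1
      rw [Metric.mem_closedBall] at hzB
      linarith [lt_min hR hη]
    refine ⟨z, ⟨hRΩ ?_, hzL⟩, hzx.trans_le (min_le_right _ _), hz.trans_lt hj1, ?_⟩
    · rw [mem_ball_iff_norm]; exact hzx.trans_le (min_le_left _ _)
    · have h1 : ⟪f, z - x⟫ = 3 / 2 * δ j + ⟪f, z - w⟫ := by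
        have : z - x = (3 / 2 * δ j) • f + (z - w) := by rw [hw]; abel
        rw [this, inner_add_right, inner_smul_right, real_inner_self_eq_norm_sq, hf1]; ring
      have h2 : |⟪f, z - w⟫| ≤ δ j := by
        refine (abs_real_inner_le_norm f (z - w)).trans ?_
        rw [hf1, one_mul, ← dist_eq_norm]; exact hzB
      have h3 : 0 < ⟪f, z - x⟫ := by
        have := (abs_le.1 h2).1
        linarith [hδ j]
      rw [hf, real_inner_smul_left] at h3
      exact (mul_pos_iff_of_pos_left (by positivity)).1 h3

end

/-! ### Choice of a representative and conclusion -/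

section

variable {Ω : Set Plane} {u v : Plane → Plane}

theorem IsDivFree.congr (h : IsDivFree Ω u) (huv : v =ᵐ[volume.restrict Ω] u) : IsDivFree Ω v := by
  intro φ hφ
  rw [← h φ hφ]
  refine integral_congr_ae ?_
  filter_upwards [huv] with x hx
  rw [hx]

theorem IsWeakDeriv.congr {G : Plane → Plane →L[ℝ] Plane} (h : IsWeakDeriv Ω u G)
    (huv : v =ᵐ[volume.restrict Ω] u) : IsWeakDeriv Ω v G := by
  intro φ hφ e
  rw [← h φ hφ e]
  refine integral_congr_ae ?_
  filter_upwards [huv] with x hx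
  rw [hx]

theorem MemLpLoc.integrableOn {F : Type*} [NormedAddCommGroup F] {p : ℝ} (hp : 1 ≤ p)
    {f : Plane → F} (h : MemLpLoc p Ω f) {K : Set Plane} (hK : IsCompact K) (hKΩ : K ⊆ Ω) :
    IntegrableOn f K := by
  have : IsFiniteMeasure (volume.restrict K) :=
    ⟨by rw [Measure.restrict_apply_univ]; exact hK.measure_lt_top⟩
  exact (h K hK hKΩ).integrable (by simpa using ENNReal.ofReal_le_ofReal hp)

/-- A representative that is measurable and of unit length everywhere. -/
theorem exists_measurable_representative (hΩ : IsOpen Ω) {p : ℝ} (hp : 1 ≤ p)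
    (h : MemLpLoc p Ω u) (hu1 : ∀ᵐ x ∂volume.restrict Ω, ‖u x‖ = 1) :
    ∃ v : Plane → Plane, Measurable v ∧ (∀ x, ‖v x‖ = 1) ∧ v =ᵐ[volume.restrict Ω] u := by
  have hli : LocallyIntegrableOn u Ω :=
    (locallyIntegrableOn_iff hΩ.isLocallyClosed).2 fun K hKΩ hK => h.integrableOn hp hK hKΩ
  have hm := hli.aestronglyMeasurable
  set f := hm.mk u with hf
  have hfm : Measurable f := hm.stronglyMeasurable_mk.measurable
  classical
  refine ⟨fun x => if ‖f x‖ = 1 then f x else EuclideanSpace.single 0 1, ?_, ?_, ?_⟩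
  · exact Measurable.ite (measurableSet_eq_fun hfm.norm measurable_const) hfm measurable_const
  · intro x
    dsimp only
    split_ifs with hx
    · exact hx
    · simp
  · filter_upwards [hm.ae_eq_mk, hu1] with x hx h1
    rw [← hf] at hx
    rw [hx] at h1
    rw [if_pos h1, hx]

/-- The weak-derivative alternative has order `1 / p = 1`. In the other one the kernel exponent `2 +
s * p` with `s = 1 / p` is 3 whatever `p` is, exactly the weight of the cubic estimate. -/
theorem commutatorVanishes_of_memSobolevLoc (hΩ : IsOpen Ω) {p : ℝ} (hp : p ∈ Set.Icc (1 : ℝ) 3)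
    (hu : MemSobolevLoc (1 / p) p Ω u) (hv : Measurable v) (hv1 : ∀ x, ‖v x‖ = 1)
    (huv : v =ᵐ[volume.restrict Ω] u) : CommutatorVanishes Ω v := by
  obtain ⟨hp1, hp3⟩ := hp
  rcases hu.2 with ⟨-, G, hG, hGw⟩ | ⟨-, -, hG⟩
  · exact commutatorVanishes_of_isWeakDeriv hΩ hv hv1 (hGw.congr huv)
      fun K hK hKΩ => hG.integrableOn hp1 hK hKΩ
  · refine commutatorVanishes_of_gagliardo hΩ hp1 hp3 hv hv1 fun K hK hKΩ => ?_
    refine lt_of_eq_of_lt ?_ (hG K hK hKΩ)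
    have huvK : v =ᵐ[volume.restrict K] u := ae_restrict_of_ae_restrict_of_subset hKΩ huv
    have e : 2 + 1 / p * p = 3 := by
      rw [one_div_mul_cancel (by linarith)]; norm_num
    refine lintegral_congr_ae ?_
    filter_upwards [huvK] with x hx
    refine lintegral_congr_ae ?_
    filter_upwards [huvK] with y hy
    simp only [gagliardoKernel, hx, hy, e]

end

theorem theorem1 (Ω : Set Plane) (hΩ : IsOpen Ω) (p : ℝ) (hp : p ∈ Set.Icc (1 : ℝ) 3)
    (u : Plane → Plane) (hu : MemSobolevDiv (1 / p) p Ω u) :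
    ∃ (v : Plane → Plane) (S : Set Plane),
      v =ᵐ[volume.restrict Ω] u ∧
      S ⊆ Ω ∧
      (∀ x ∈ Ω, ∃ V ∈ 𝓝 x, (V ∩ S).Finite) ∧
      LocallyLipschitzOn (Ω \ S) v ∧
      ∀ P ∈ S, ∃ α : ℝ, (α = 1 ∨ α = -1) ∧
        ∀ U : Set Plane, U ∈ 𝓝 P → Convex ℝ U → U ⊆ Ω →
          ∀ x ∈ U, x ≠ P → v x = (α / ‖x - P‖) • perp (x - P) := by
  obtain ⟨m, hm, hm1, hmu⟩ := exists_measurable_representative hΩ hp.1 hu.sobolev.1 hu.unit_length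
  have H := isCharacteristicField hΩ hm hm1 (hu.div_free.congr hmu)
    (commutatorVanishes_of_memSobolevLoc hΩ hp hu.sobolev hm hm1 hmu)
  obtain ⟨v, S, hv, hS, hfin, hlip, hvortex⟩ := H.regularity hΩ Set.inter_subset_left
  refine ⟨v, S, ?_, hS, hfin, hlip, hvortex⟩
  filter_upwards [hmu, ae_restrict_mem hΩ.measurableSet, ae_restrict_of_ae
    (ae_isLebesguePoint (locallyIntegrable_of_norm_eq_one hm hm1))] with x hx hxΩ hxL
  rw [hv x ⟨hxΩ, hxL⟩, hx]
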